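/- Let $n,m\ge 1$ and $D_t=-i\partial_t$, $D_{x_j}=-i\partial_{x_j}$. Let $A(t,\xi)=(a_{ij}(t,\xi))_{i,j=1}^m$, $t\in\mathbb R$, $\xi\in\mathbb R^n\setminus 0$, be complex-valued, continuous in $\xi$ for each $t$, and positively homogeneous of order one in $\xi$. Assume that, for all $i,j$ and $\xi\ne 0$, $a_{ij}(\cdot,\xi)$ is locally Lipschitz on $\mathbb R$ and $\partial_t a_{ij}(\cdot,\xi)\in L^1(\mathbb R)$, with $\sup_{|\xi|=1}\int_{\mathbb R}|\partial_t a_{ij}(t,\xi)|\,dt<\infty$. Assume that $\det(\tau I-A(t,\xi))=0$ has (in $\tau$) only real roots $\varphi_1(t,\xi),\dots,\varphi_m(t,\xi)$, labelled continuously in $t$, and that $$\inf_{t\in\mathbb R,\ |\xi|=1,\ j\ne k}|\varphi_j(t,\xi)-\varphi_k(t,\xi)|>0 .$$ Let $a_{ij}^\pm(\xi)=\lim_{t\to\pm\infty}a_{ij}(t,\xi)$, $A_\pm=(a_{ij}^\pm)$ and $\varphi_j^\pm(\xi)=\lim_{t\to\pm\infty}\varphi_j(t,\xi)$, and assume that,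 for all $j$ and all $\xi\neq0$, the functions $\int_0^t(\varphi_j(s,\xi)-\varphi_j^\pm(\xi))\,ds$ have finite limits as $t\to\pm\infty$ (for both signs). Let $A(t,D_x)$ and $A_\pm(D_x)$ be the Fourier multipliers with symbols $A(t,\xi)$ and $A_\pm(\xi)$. Solutions of $D_tU=A(t,D_x)U$ and of $D_tV=A_\pm(D_x)V$ are understood to lie in $C(\mathbb R;(L^2(\mathbb R^n))^m)$ and to satisfy the equation weakly on $\mathbb R$, i.e. tested against Schwartz functions of $x$. Suppose in addition that $a_{ij}^+(\xi)=a_{ij}^-(\xi)$ for all $i,j$ and $\xi\ne0$. Then the following holds. Every element of $(L^2(\mathbb R^n))^m$ is the value at $t=0$ of a unique solution of each of these systems. For either sign and every solution $V_\pm$ of $D_tV_\pm=A_\pm(D_x)V_\pm$ there is a unique solution $U$ of $D_tU=A(t,D_x)U$ with $\|U(t)-V_\pm(t)\|_{(L^2(\mathbb R^n))^m}\to0$ as $t\to\pm\infty$, and the wave operators $\mathscr W_\pm:V_\pm(0)\mapsto U(0)$ so defined are bounded linear bijections of $(L^2(\mathbb R^n))^m$ with bounded inverses $\mathscr W_\pm^{-1}:U(0)\mapsto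 V_\pm(0)$. Moreover $$S=\mathscr W_+^{-1}\mathscr W_-:\ V_-(0)\mapsto V_+(0)$$ is a well-defined scattering operator: $Sf=g$ if and only if there are a solution $U$ of $D_tU=A(t,D_x)U$ and solutions $V_\pm$ of $D_tV_\pm=A_\pm(D_x)V_\pm$ with $V_-(0)=f$, $V_+(0)=g$ and $\|U(t)-V_\pm(t)\|_{(L^2(\mathbb R^n))^m}\to0$ as $t\to\pm\infty$. It is linear, bijective and bounded on $(L^2(\mathbb R^n))^m$, and so is its inverse. -/

import Mathlib

open MeasureTheory Filter Topology Set
open scoped FourierTransform SchwartzMap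

noncomputable section

namespace HypSys

/-- The Euclidean space `ℝⁿ`. -/
abbrev Rn (n : ℕ) : Type := EuclideanSpace ℝ (Fin n)

/-- The Hermitian space `ℂᵐ`. -/
abbrev Cm (m : ℕ) : Type := EuclideanSpace ℂ (Fin m)

/-- The Hilbert space `(L²(ℝⁿ))ᵐ`, realised as `L²(ℝⁿ; ℂᵐ)`. -/
abbrev L2 (n m : ℕ) : Type := Lp (Cm m) 2 (volume : Measure (Rn n))

/-- A time-independent `m × m` matrix symbol `σ(ξ)`. -/
abbrev Symbol (n m : ℕ) : Type := Rn n → Matrix (Fin m) (Fin m) ℂ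

/-- The Fourier transform of `σ(D_x) u`, where `D_{x_j} = -i ∂_{x_j}` and `u ∈ (L²)ᵐ`.
With the normalisation `𝓕 u (ξ) = ∫ exp (-2πi⟨x, ξ⟩) u x dx` of the Fourier transform, `D_{x_j}`
becomes multiplication by `2π ξ_j`, so `σ(D_x)` becomes multiplication by `σ (2π ξ)`. -/
def fourierOfMultiplier {n m : ℕ} (σ : Symbol n m) (u : L2 n m) (ξ : Rn n) : Cm m :=
  WithLp.toLp 2 ((σ ((2 * Real.pi) • ξ)).mulVec (WithLp.ofLp ((𝓕 u : L2 n m) ξ)))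

/-- The pairing `⟨χ, σ(D_x) u⟩` of the tempered distribution `σ(D_x) u` with a Schwartz function
`χ` (antilinear in `χ`), computed on the Fourier side. -/
def multiplierPairing {n m : ℕ} (σ : Symbol n m) (u : L2 n m) (χ : 𝓢(Rn n, Cm m)) : ℂ :=
  ∫ ξ : Rn n, inner ℂ ((𝓕 χ : 𝓢(Rn n, Cm m)) ξ) (fourierOfMultiplier σ u ξ)

/-- `U ∈ C(ℝ; (L²(ℝⁿ))ᵐ)` is a (weak) solution of `D_t U = A(t, D_x) U`, `D_t = -i ∂_t`, that is
`∂_t U = i A(t, D_x) U`: for every vector-valued Schwartz function `χ` one has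
`(d/dt) ⟨χ, U(t)⟩ = i ⟨χ, A(t, D_x) U(t)⟩` at every time `t`. -/
def IsSolution {n m : ℕ} (A : ℝ → Symbol n m) (U : ℝ → L2 n m) : Prop :=
  Continuous U ∧
    ∀ (χ : 𝓢(Rn n, Cm m)) (t : ℝ),
      HasDerivAt (fun s : ℝ => ∫ x : Rn n, inner ℂ (χ x) (U s x))
        (Complex.I * multiplierPairing (A t) (U t) χ) t

/-- `V ∈ C(ℝ; (L²(ℝⁿ))ᵐ)` is a solution of the system `D_t V = B(D_x) V` with constant
coefficients. -/
def IsFreeSolution {n m : ℕ} (B : Symbol n m) (V : ℝ → L2 n m) : Prop :=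
  IsSolution (fun _ : ℝ => B) V

/-- `‖U(t) - V(t)‖ → 0` in `(L²(ℝⁿ))ᵐ` along `l` (`l = atTop` for `t → +∞`, `l = atBot` for
`t → -∞`). -/
def Asymptotic {n m : ℕ} (l : Filter ℝ) (U V : ℝ → L2 n m) : Prop :=
  Tendsto (fun t : ℝ => ‖U t - V t‖) l (𝓝 0)

/-- The standing assumptions on the coefficients `A(t, ξ) = (a_{ij}(t, ξ))`, `ξ ≠ 0`: they are
positively homogeneous of order one and continuous in `ξ`, locally Lipschitz in `t`, and
`∂_t a_{ij}(·, ξ) ∈ L¹(ℝ)` with norm bounded for `|ξ| = 1`. -/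
structure IsAdmissible {n m : ℕ} (A : ℝ → Symbol n m) : Prop where
  homogeneous : ∀ (t r : ℝ) (ξ : Rn n), 0 < r → ξ ≠ 0 → A t (r • ξ) = (r : ℂ) • A t ξ
  continuousOn : ∀ (t : ℝ) (i j : Fin m), ContinuousOn (fun ξ : Rn n => A t ξ i j) {0}ᶜ
  locallyLipschitz : ∀ (ξ : Rn n) (i j : Fin m), ξ ≠ 0 → LocallyLipschitz (fun t : ℝ => A t ξ i j)
  integrable_deriv : ∀ (ξ : Rn n) (i j : Fin m), ξ ≠ 0 →
    Integrable (deriv (fun t : ℝ => A t ξ i j)) volume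
  bound_deriv : ∃ M : ℝ, ∀ (ξ : Rn n) (i j : Fin m), ‖ξ‖ = 1 →
    ∫ t : ℝ, ‖deriv (fun s : ℝ => A s ξ i j) t‖ ≤ M

/-- Regular hyperbolicity: `det (τ I - A(t, ξ)) = 0` has the real roots
`φ₁(t, ξ), …, φ_m(t, ξ)`, labelled continuously in `t`, and
`inf_{t ∈ ℝ, |ξ| = 1, j ≠ k} |φ_j(t, ξ) - φ_k(t, ξ)| > 0`. -/
structure IsRegularlyHyperbolic {n m : ℕ} (A : ℝ → Symbol n m)
    (φ : Fin m → ℝ → Rn n → ℝ) : Prop where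
  det_eq : ∀ (t : ℝ) (ξ : Rn n) (τ : ℂ), ξ ≠ 0 →
    (τ • (1 : Matrix (Fin m) (Fin m) ℂ) - A t ξ).det = ∏ j : Fin m, (τ - (φ j t ξ : ℂ))
  continuous_root : ∀ (j : Fin m) (ξ : Rn n), ξ ≠ 0 → Continuous (fun t : ℝ => φ j t ξ)
  gap : ∃ d : ℝ, 0 < d ∧ ∀ (t : ℝ) (ξ : Rn n) (j k : Fin m), ‖ξ‖ = 1 → j ≠ k →
    d ≤ |φ j t ξ - φ k t ξ|

/-- `B` is the limit of the coefficients along `l`: `a_{ij}(t, ξ) → b_{ij}(ξ)` for `ξ ≠ 0`. -/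
def IsLimitSymbol {n m : ℕ} (A : ℝ → Symbol n m) (l : Filter ℝ) (B : Symbol n m) : Prop :=
  ∀ (ξ : Rn n) (i j : Fin m), ξ ≠ 0 → Tendsto (fun t : ℝ => A t ξ i j) l (𝓝 (B ξ i j))

/-- `φ_j^l(ξ)` is the limit of the root `φ_j(t, ξ)` along `l`, for every `j` and `ξ ≠ 0`. -/
def IsLimitRoot {n m : ℕ} (φ : Fin m → ℝ → Rn n → ℝ) (l : Filter ℝ)
    (φl : Fin m → Rn n → ℝ) : Prop :=
  ∀ (j : Fin m) (ξ : Rn n), ξ ≠ 0 → Tendsto (fun t : ℝ => φ j t ξ) l (𝓝 (φl j ξ))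

/-- Stability of the roots: `∫₀ᵗ (φ_j(s, ξ) - φ_j^l(ξ)) ds` has a finite limit along `l`, for every
`j` and every `ξ ≠ 0`. -/
def IsStable {n m : ℕ} (φ : Fin m → ℝ → Rn n → ℝ) (l : Filter ℝ)
    (φl : Fin m → Rn n → ℝ) : Prop :=
  ∀ (j : Fin m) (ξ : Rn n), ξ ≠ 0 →
    ∃ θ : ℝ, Tendsto (fun t : ℝ => ∫ s in (0 : ℝ)..t, (φ j s ξ - φl j ξ)) l (𝓝 θ)

/-- `W` is the wave operator `V(0) ↦ U(0)` along `l`: every `f` is the datum `V(0)` of a unique free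
solution `V`, to every free solution `V` there is a unique solution `U` of `D_t U = A(t, D_x) U`
with `‖U(t) - V(t)‖ → 0`, and `W (V(0)) = U(0)`. -/
def IsWaveOperator {n m : ℕ} (A : ℝ → Symbol n m) (B : Symbol n m) (l : Filter ℝ)
    (W : L2 n m → L2 n m) : Prop :=
  (∀ f : L2 n m, ∃! V : ℝ → L2 n m, IsFreeSolution B V ∧ V 0 = f) ∧
  (∀ V : ℝ → L2 n m, IsFreeSolution B V →
    ∃! U : ℝ → L2 n m, IsSolution A U ∧ Asymptotic l U V) ∧
  (∀ U V : ℝ → L2 n m, IsSolution A U → IsFreeSolution B V → Asymptotic l U V → W (V 0) = U 0)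

/-- `W'` is the inverse `U(0) ↦ V(0)` of the wave operator along `l`: every `g` is the datum `U(0)`
of a unique solution `U` of `D_t U = A(t, D_x) U`, to every such `U` there is a unique free solution
`V` with `‖U(t) - V(t)‖ → 0`, and `W' (U(0)) = V(0)`. -/
def IsInverseWaveOperator {n m : ℕ} (A : ℝ → Symbol n m) (B : Symbol n m) (l : Filter ℝ)
    (W' : L2 n m → L2 n m) : Prop :=
  (∀ g : L2 n m, ∃! U : ℝ → L2 n m, IsSolution A U ∧ U 0 = g) ∧
  (∀ U : ℝ → L2 n m, IsSolution A U →
    ∃! V : ℝ → L2 n m, IsFreeSolution B V ∧ Asymptotic l U V) ∧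
  (∀ U V : ℝ → L2 n m, IsSolution A U → IsFreeSolution B V → Asymptotic l U V → W' (U 0) = V 0)

/-- `S` is the scattering operator `V₋(0) ↦ V₊(0)`: `S f = g` exactly when some solution `U` of
`D_t U = A(t, D_x) U` is asymptotic, as `t → -∞`, to a solution `V₋` of `D_t V₋ = B₋(D_x) V₋` with
`V₋(0) = f` and, as `t → +∞`, to a solution `V₊` of `D_t V₊ = B₊(D_x) V₊` with `V₊(0) = g`. -/
def IsScatteringOperator {n m : ℕ} (A : ℝ → Symbol n m) (Bm Bp : Symbol n m)
    (S : L2 n m → L2 n m) : Prop :=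
  ∀ f g : L2 n m, S f = g ↔
    ∃ Vm U Vp : ℝ → L2 n m, IsFreeSolution Bm Vm ∧ IsSolution A U ∧ IsFreeSolution Bp Vp ∧
      Asymptotic atBot U Vm ∧ Asymptotic atTop U Vp ∧ Vm 0 = f ∧ Vp 0 = g

end HypSys

end

/-! ### Calculus of locally Lipschitz functions on the line. -/

namespace HypSys

/-! After a Fourier transform in `x` the system is, at each frequency `ξ ≠ 0`, an ordinary
differential equation `U' = i r M(t) U` on `ℂᵐ` with `r = 2π|ξ|` and, by homogeneity, `M(t) = A(t,
ξ/|ξ|)`. The difficulty is that `r` is unbounded, so estimates must not involve it.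

Let `P_j(t)` be the spectral projections of `M(t)` and `ψ_j(t)` its roots. The profiles `w_j =
exp(-i r ∫₀ᵗ ψ_j) P_j U` satisfy `w_j' = exp(-i r ∫₀ᵗ ψ_j) P_j' U`: the terms with `r` cancel
(`hasDerivAt_profile`). The uniform gap makes roots and projections Lipschitz functions of `M`, with
constants depending only on `m`, a bound for `M` and the gap, so `|P_j'|` is controlled by `|M'|`,
which is integrable in `t` uniformly over the sphere. Grönwall's inequality bounds the evolution
uniformly in time and frequency (`exists_norm_solution_le`), and the same integrability makes each
`w_j` converge as `t → ±∞`.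

Undoing the limiting evolution multiplies the `j`-th component by `exp(-i r t χ_j)`, with `χ_j` the
limit root. Stability says that `∫₀ᵗ (ψ_j - χ_j)` converges, so the mismatch of phases converges
too, and with it the comparison symbol (free evolution)⁻¹ · (evolution), pointwise in `ξ`
(`exists_tendsto_propagator_apply`). Since the symbols and their inverses are bounded, dominated
convergence turns this into strong convergence on `L²`, and the limit is invertible
(`exists_waveOperator`). The scattering operator is the composition of one wave operator with the
inverse of the other.

Passing between weak solutions and these multipliers takes well-posedness in `L²`: the fundamental
solution is a Dyson series, hence measurable in `ξ`, and uniqueness follows by cutting off in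
frequency, where the equation has bounded coefficients. -/

/-- A map dominated near each point by a locally Lipschitz map is locally Lipschitz. -/
theorem locallyLipschitz_of_dist_le {X Y Z : Type*} [PseudoMetricSpace X] [PseudoMetricSpace Y]
    [PseudoMetricSpace Z] {f : X → Y} {g : X → Z} (hg : LocallyLipschitz g)
    (h : ∀ x, ∃ C : NNReal, ∃ t ∈ 𝓝 x, ∀ u ∈ t, ∀ v ∈ t,
      dist (f u) (f v) ≤ C * dist (g u) (g v)) : LocallyLipschitz f := by
  intro x
  obtain ⟨C, t, ht, hC⟩ := h x
  obtain ⟨K, s, hs, hK⟩ := hg x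
  refine ⟨C * K, t ∩ s, inter_mem ht hs, LipschitzOnWith.of_dist_le_mul fun u hu v hv => ?_⟩
  calc dist (f u) (f v) ≤ C * dist (g u) (g v) := hC u hu.1 v hv.1
    _ ≤ C * (K * dist u v) := by gcongr; exact hK.dist_le_mul u hu.2 v hv.2
    _ = _ := by push_cast; ring

theorem locallyLipschitz_pi {X ι : Type*} [PseudoMetricSpace X] [Fintype ι] {E : ι → Type*}
    [∀ i, PseudoMetricSpace (E i)] {f : X → ∀ i, E i}
    (h : ∀ i, LocallyLipschitz fun x => f x i) : LocallyLipschitz f := by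
  intro x
  choose K u hu hK using fun i => h i x
  refine ⟨Finset.univ.sup K, ⋂ j, u j, (Filter.iInter_mem).2 hu, ?_⟩
  refine LipschitzOnWith.of_dist_le_mul fun a ha b hb => ?_
  rw [dist_pi_le_iff (by positivity)]
  intro j
  refine ((hK j).dist_le_mul a (mem_iInter.1 ha j) b (mem_iInter.1 hb j)).trans ?_
  gcongr
  exact_mod_cast Finset.le_sup (f := K) (Finset.mem_univ j)

theorem exists_lipschitzOnWith_uIcc {E : Type*} [NormedAddCommGroup E]
    {f : ℝ → E} (hf : LocallyLipschitz f) (s t : ℝ) : ∃ K, LipschitzOnWith K f (uIcc s t) :=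
  (hf.locallyLipschitzOn (s := uIcc s t)).exists_lipschitzOnWith_of_compact isCompact_uIcc

theorem ae_differentiableAt_of_locallyLipschitz {E : Type*} [NormedAddCommGroup E] [NormedSpace ℝ E]
    [FiniteDimensional ℝ E] {f : ℝ → E} (hf : LocallyLipschitz f) :
    ∀ᵐ x, DifferentiableAt ℝ f x := by
  apply LocallyBoundedVariationOn.ae_differentiableAt
  intro a b _ _
  obtain ⟨K, hK⟩ := exists_lipschitzOnWith_uIcc hf a b
  rw [univ_inter]
  by_cases hab : a ≤ b
  · simpa using (hK.mono Icc_subset_uIcc).locallyBoundedVariationOn a b (left_mem_Icc.2 hab)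
      (right_mem_Icc.2 hab)
  · simp [BoundedVariationOn, Icc_eq_empty hab]

/-- The increment of a locally Lipschitz function is controlled by the integral of a bound for its
derivative. -/
theorem norm_sub_le_integral_of_norm_deriv_le {E : Type*} [NormedAddCommGroup E] [NormedSpace ℝ E]
    [FiniteDimensional ℝ E] {f : ℝ → E} (hf : LocallyLipschitz f) {β : ℝ → ℝ} {s t : ℝ}
    (hst : s ≤ t) (hβ : IntervalIntegrable β volume s t) (h : ∀ᵐ x, ‖deriv f x‖ ≤ β x) :
    ‖f t - f s‖ ≤ ∫ x in s..t, β x := by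
  -- A norming functional reduces the claim to a real-valued function, to which the fundamental
  -- theorem of calculus for absolutely continuous functions applies.
  obtain ⟨g, hg, hgx⟩ := exists_dual_vector'' ℝ (f t - f s)
  have hgf : LocallyLipschitz (fun x => g (f x)) := g.lipschitz.locallyLipschitz.comp hf
  obtain ⟨K, hK⟩ := exists_lipschitzOnWith_uIcc hgf s t
  have hac := hK.absolutelyContinuousOnInterval
  have h1 := hac.integral_deriv_eq_sub
  simp only [map_sub, RCLike.ofReal_real_eq_id, id] at hgx
  rw [← hgx, ← h1]
  refine intervalIntegral.integral_mono_ae hst hac.intervalIntegrable_deriv hβ ?_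
  filter_upwards [h, ae_differentiableAt_of_locallyLipschitz hf] with x hx hd
  have : deriv (fun x => g (f x)) x = g (deriv f x) := (g.hasFDerivAt.comp_hasDerivAt x hd.hasDerivAt).deriv
  rw [this]
  calc g (deriv f x) ≤ ‖g (deriv f x)‖ := le_abs_self _
    _ ≤ ‖g‖ * ‖deriv f x‖ := g.le_opNorm _
    _ ≤ 1 * ‖deriv f x‖ := by gcongr
    _ ≤ β x := by simpa using hx

theorem norm_sub_le_integral_univ {E : Type*} [NormedAddCommGroup E] [NormedSpace ℝ E]
    [FiniteDimensional ℝ E] {f : ℝ → E} (hf : LocallyLipschitz f) {β : ℝ → ℝ}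
    (hβ : Integrable β) (h : ∀ᵐ x, ‖deriv f x‖ ≤ β x) (s t : ℝ) :
    ‖f t - f s‖ ≤ ∫ x, β x := by
  wlog hst : s ≤ t generalizing s t
  · rw [norm_sub_rev]; exact this t s (le_of_not_ge hst)
  refine (norm_sub_le_integral_of_norm_deriv_le hf hst hβ.intervalIntegrable h).trans ?_
  rw [intervalIntegral.integral_of_le hst]
  refine setIntegral_le_integral hβ ?_
  filter_upwards [h] with x hx using (norm_nonneg _).trans hx

theorem abs_log_sub_log_le {ε a b : ℝ} (hε : 0 < ε) (ha : ε ≤ a) (hb : ε ≤ b) :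
    |Real.log a - Real.log b| ≤ ε⁻¹ * |a - b| := by
  wlog hab : b ≤ a generalizing a b
  · rw [abs_sub_comm, abs_sub_comm a]; exact this hb ha (le_of_not_ge hab)
  have hb0 := hε.trans_le hb
  have ha0 := hε.trans_le ha
  rw [abs_of_nonneg (sub_nonneg.2 (Real.log_le_log hb0 hab)), abs_of_nonneg (sub_nonneg.2 hab),
    ← Real.log_div ha0.ne' hb0.ne']
  calc Real.log (a / b) ≤ a / b - 1 := Real.log_le_sub_one_of_pos (by positivity)
    _ = b⁻¹ * (a - b) := by field_simp
    _ ≤ ε⁻¹ * (a - b) := by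
      have := sub_nonneg.2 hab
      gcongr

/-- Grönwall's inequality, in both time directions, with an integrable coefficient. -/
theorem le_exp_integral_mul_of_abs_deriv_le {N β : ℝ → ℝ} (hN : LocallyLipschitz N)
    (hN0 : ∀ x, 0 ≤ N x) (hβ : Integrable β) (h : ∀ᵐ x, |deriv N x| ≤ β x * N x)
    (hβ0 : ∀ x, 0 ≤ β x) (s t : ℝ) :
    N t ≤ Real.exp (∫ x, β x) * N s := by
  -- `N` may vanish, so the logarithm is taken of `N + ε`; its derivative is bounded by `β`, and `ε
  -- → 0` at the end.
  have key : ∀ ε : ℝ, 0 < ε → N t + ε ≤ Real.exp (∫ x, β x) * (N s + ε) := by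
    intro ε hε
    have hpos : ∀ x, 0 < N x + ε := fun x => add_pos_of_nonneg_of_pos (hN0 x) hε
    have hL : LocallyLipschitz (fun x => Real.log (N x + ε)) := by
      refine locallyLipschitz_of_dist_le hN fun x => ⟨ε⁻¹.toNNReal, univ, univ_mem, ?_⟩
      intro u _ v _
      have := abs_log_sub_log_le hε (a := N u + ε) (b := N v + ε) (by linarith [hN0 u])
        (by linarith [hN0 v])
      simpa only [Real.dist_eq, Real.coe_toNNReal _ (inv_nonneg.2 hε.le), add_sub_add_right_eq_sub] using this
    have := norm_sub_le_integral_univ hL hβ (by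
      filter_upwards [h, ae_differentiableAt_of_locallyLipschitz hN] with x hx hd
      have hd' : HasDerivAt (fun x => Real.log (N x + ε)) (deriv N x / (N x + ε)) x :=
        (hd.hasDerivAt.add_const ε).log (hpos x).ne'
      rw [hd'.deriv, Real.norm_eq_abs, abs_div, abs_of_pos (hpos x), div_le_iff₀ (hpos x)]
      nlinarith [hβ0 x]) s t
    have h2 := (le_abs_self _).trans this
    rw [sub_le_iff_le_add, Real.log_le_iff_le_exp (hpos t), Real.exp_add,
      Real.exp_log (hpos s)] at h2
    exact h2
  refine le_of_tendsto_of_tendsto (f := fun ε => N t + ε)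
    (g := fun ε => Real.exp (∫ x, β x) * (N s + ε)) (b := 𝓝[>] (0 : ℝ)) ?_ ?_ ?_
  · exact ((continuous_const.add continuous_id).tendsto' 0 (N t) (by simp)).mono_left
      nhdsWithin_le_nhds
  · exact ((continuous_const.mul (continuous_const.add continuous_id)).tendsto' 0 _
      (by simp)).mono_left nhdsWithin_le_nhds
  · filter_upwards [self_mem_nhdsWithin] with ε hε using key ε hε

/-- A locally Lipschitz function with integrable derivative converges along `atTop` and `atBot`. -/
theorem exists_tendsto_of_integrable_deriv {E : Type*} [NormedAddCommGroup E] [NormedSpace ℝ E]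
    [FiniteDimensional ℝ E] {f : ℝ → E} (hf : LocallyLipschitz f) {β : ℝ → ℝ}
    (hβ : Integrable β) (h : ∀ᵐ x, ‖deriv f x‖ ≤ β x) {l : Filter ℝ} (hl : l = atTop ∨ l = atBot) :
    ∃ v, Tendsto f l (𝓝 v) := by
  have : CompleteSpace E := FiniteDimensional.complete ℝ E
  -- The oscillation of `f` is dominated by that of a primitive of `β`; the primitive converges, so
  -- `f` is Cauchy along `l`.
  have hle : ∀ s t, ‖f t - f s‖ ≤ |(∫ x in (0:ℝ)..t, β x) - ∫ x in (0:ℝ)..s, β x| := by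
    intro s t
    wlog hst : s ≤ t generalizing s t
    · rw [norm_sub_rev, abs_sub_comm]; exact this t s (le_of_not_ge hst)
    refine (norm_sub_le_integral_of_norm_deriv_le hf hst hβ.intervalIntegrable h).trans ?_
    rw [intervalIntegral.integral_interval_sub_left hβ.intervalIntegrable hβ.intervalIntegrable]
    exact le_abs_self _
  have hc : ∃ c, Tendsto (fun t => ∫ x in (0:ℝ)..t, β x) l (𝓝 c) := by
    rcases hl with rfl | rfl
    · exact ⟨_, intervalIntegral_tendsto_integral_Ioi 0 hβ.integrableOn tendsto_id⟩
    · refine ⟨_, ((intervalIntegral_tendsto_integral_Iic 0 hβ.integrableOn tendsto_id).neg).congr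
        fun t => ?_⟩
      rw [intervalIntegral.integral_symm]; simp
  obtain ⟨c, hc⟩ := hc
  have hlne : l.NeBot := by rcases hl with rfl | rfl <;> infer_instance
  have hcau := hc.cauchy_map
  refine cauchy_map_iff_exists_tendsto.1 ?_
  rw [Metric.cauchy_iff] at hcau ⊢
  refine ⟨hlne.map _, fun ε hε => ?_⟩
  obtain ⟨t, ht, hε⟩ := hcau.2 ε hε
  refine ⟨f '' ((fun t => ∫ x in (0:ℝ)..t, β x) ⁻¹' t), image_mem_map ht, ?_⟩
  rintro _ ⟨u, hu, rfl⟩ _ ⟨v, hv, rfl⟩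
  rw [dist_eq_norm]
  exact (hle v u).trans_lt (hε _ hu _ hv)

end HypSys

/-! ### Spectral projections of matrices with real, separated characteristic roots. -/

namespace HypSys

/-- Bounded operators on `ℂᵐ`. -/
abbrev Op (m : ℕ) : Type := Cm m →L[ℂ] Cm m

/-- The operator on `ℂᵐ` defined by a matrix. -/
noncomputable abbrev toOp {m : ℕ} (M : Matrix (Fin m) (Fin m) ℂ) : Op m :=
  Matrix.toEuclideanCLM (n := Fin m) (𝕜 := ℂ) M

/-- `M` has the characteristic roots `ψ`. -/
def HasRoots {m : ℕ} (M : Matrix (Fin m) (Fin m) ℂ) (ψ : Fin m → ℝ) : Prop :=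
  ∀ τ : ℂ, (τ • (1 : Matrix (Fin m) (Fin m) ℂ) - M).det = ∏ j : Fin m, (τ - (ψ j : ℂ))

/-- The spectral projection of `B` for the eigenvalue `ψ j`, as a Lagrange polynomial in `B`. -/
noncomputable def specProj {m : ℕ} (B : Op m) (ψ : Fin m → ℝ) (j : Fin m) : Op m :=
  Polynomial.aeval B (Lagrange.basis Finset.univ (fun k => (ψ k : ℂ)) j)

variable {m : ℕ}

/-- Only an inequality, because the identity is zero when `m = 0`. -/
theorem op_norm_one_le : ‖(1 : Op m)‖ ≤ 1 := ContinuousLinearMap.norm_id_le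

theorem sum_specProj {B : Op m} {ψ : Fin m → ℝ} (hψ : Function.Injective ψ) :
    ∑ j, specProj B ψ j = 1 := by
  rcases Nat.eq_zero_or_pos m with rfl | hm
  · ext v i; exact i.elim0
  · have : Nonempty (Fin m) := ⟨⟨0, hm⟩⟩
    have h := Lagrange.sum_basis (F := ℂ) (s := (Finset.univ : Finset (Fin m)))
      (v := fun k => (ψ k : ℂ)) (fun a _ b _ h => hψ (by simpa using h)) Finset.univ_nonempty
    simp only [specProj, ← map_sum, h, map_one]

/-- Cayley–Hamilton: the product is the characteristic polynomial, as both have the same values. -/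
theorem aeval_prod_roots {M : Matrix (Fin m) (Fin m) ℂ} {ψ : Fin m → ℝ} (h : HasRoots M ψ) :
    Polynomial.aeval (toOp M)
      (∏ k : Fin m, (Polynomial.X - Polynomial.C (ψ k : ℂ))) = 0 := by
  have hc : M.charpoly = ∏ k : Fin m, (Polynomial.X - Polynomial.C (ψ k : ℂ)) := by
    refine Polynomial.funext fun τ => ?_
    rw [Matrix.eval_charpoly, Polynomial.eval_prod]
    simpa [Matrix.smul_one_eq_diagonal] using h τ
  rw [← hc]
  have := Polynomial.aeval_algHom_apply (Matrix.toEuclideanCLM (n := Fin m) (𝕜 := ℂ)).toAlgEquiv.toAlgHom M M.charpoly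
  rw [Matrix.aeval_self_charpoly, map_zero] at this
  exact this

/-- The `j`-th Lagrange polynomial times `X - ψ_j` is a scalar multiple of the characteristic
polynomial, which annihilates the operator. -/
theorem specProj_mul {M : Matrix (Fin m) (Fin m) ℂ} {ψ : Fin m → ℝ} (h : HasRoots M ψ)
    (j : Fin m) : specProj (toOp M) ψ j * toOp M = (ψ j : ℂ) • specProj (toOp M) ψ j := by
  have hp : Lagrange.basis Finset.univ (fun k => (ψ k : ℂ)) j *
      (Polynomial.X - Polynomial.C (ψ j : ℂ)) =
      Polynomial.C (∏ k ∈ Finset.univ.erase j, ((ψ j : ℂ) - ψ k)⁻¹) *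
        ∏ k : Fin m, (Polynomial.X - Polynomial.C (ψ k : ℂ)) := by
    rw [Lagrange.basis, ← Finset.mul_prod_erase Finset.univ _ (Finset.mem_univ j)]
    simp only [Lagrange.basisDivisor, Finset.prod_mul_distrib, map_prod]
    ring
  have := congrArg (Polynomial.aeval (toOp M)) hp
  rw [map_mul, map_mul, aeval_prod_roots h, mul_zero, map_sub, Polynomial.aeval_X,
    Polynomial.aeval_C, mul_sub, sub_eq_zero] at this
  rw [specProj, this, Algebra.algebraMap_eq_smul_one, mul_smul_comm, mul_one]

theorem abs_root_le_norm {M : Matrix (Fin m) (Fin m) ℂ} {ψ : Fin m → ℝ} (h : HasRoots M ψ)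
    (j : Fin m) : |ψ j| ≤ ‖toOp M‖ := by
  have h0 : ((ψ j : ℂ) • (1 : Matrix (Fin m) (Fin m) ℂ) - M).det = 0 := by
    rw [h]; exact Finset.prod_eq_zero (Finset.mem_univ j) (sub_self _)
  obtain ⟨v, hv, hv0⟩ := Matrix.exists_mulVec_eq_zero_iff.2 h0
  rw [Matrix.sub_mulVec, Matrix.smul_mulVec, Matrix.one_mulVec, sub_eq_zero] at hv0
  have h1 : toOp M (WithLp.toLp 2 v) = (ψ j : ℂ) • WithLp.toLp 2 v := by
    rw [Matrix.toEuclideanCLM_toLp, ← hv0]; rfl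
  have h2 := (toOp M).le_opNorm (WithLp.toLp 2 v)
  rw [h1, norm_smul, Complex.norm_real, Real.norm_eq_abs] at h2
  refine le_of_mul_le_mul_right h2 (norm_pos_iff.2 fun h => hv ?_)
  simpa using h

/-- The determinant is polynomial in `τ` and the entries, hence Lipschitz on the ball of radius `R`.
The constant depends only on `m` and `R`, which later gives uniformity over all directions `ξ/|ξ|`.
-/
theorem exists_det_lipschitz (m : ℕ) (R : ℝ) : ∃ L : ℝ, 0 ≤ L ∧
    ∀ (M N : Matrix (Fin m) (Fin m) ℂ) (τ : ℂ), ‖toOp M‖ ≤ R → ‖toOp N‖ ≤ R → ‖τ‖ ≤ R →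
      ‖(τ • (1 : Matrix (Fin m) (Fin m) ℂ) - M).det - (τ • (1 : Matrix (Fin m) (Fin m) ℂ) - N).det‖
        ≤ L * ‖toOp M - toOp N‖ := by
  let e : Op m →ₗ[ℂ] Matrix (Fin m) (Fin m) ℂ :=
    (Matrix.toEuclideanCLM (n := Fin m) (𝕜 := ℂ)).symm.toAlgEquiv.toLinearMap
  have hent : ∀ i j, ContDiff ℝ 1 (fun p : Op m × ℂ =>
      (p.2 • (1 : Matrix (Fin m) (Fin m) ℂ) - e p.1) i j) := by
    intro i j
    let l : Op m →ₗ[ℂ] ℂ := (Matrix.entryLinearMap ℂ ℂ i j).comp e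
    have hl : ContDiff ℝ 1 (fun B : Op m => l B) :=
      (l.toContinuousLinearMap.restrictScalars ℝ).contDiff
    have : (fun p : Op m × ℂ => (p.2 • (1 : Matrix (Fin m) (Fin m) ℂ) - e p.1) i j) =
        fun p => p.2 * (1 : Matrix (Fin m) (Fin m) ℂ) i j - l p.1 := by
      ext p; simp [l]
    rw [this]
    exact (contDiff_snd.mul contDiff_const).sub (hl.comp contDiff_fst)
  have hdet : ContDiff ℝ 1 (fun p : Op m × ℂ =>
      (p.2 • (1 : Matrix (Fin m) (Fin m) ℂ) - e p.1).det) := by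
    simp only [Matrix.det_apply']
    exact ContDiff.sum fun σ _ => contDiff_const.mul (contDiff_prod fun i _ => hent _ _)
  obtain ⟨K, hK⟩ := hdet.contDiffOn.exists_lipschitzOnWith (s := Metric.closedBall 0 R)
    (by decide) (convex_closedBall _ _) (isCompact_closedBall _ _)
  refine ⟨K, K.2, fun M N τ hM hN hτ => ?_⟩
  have := hK.dist_le_mul (toOp M, τ) (by simp [Prod.norm_def, hM, hτ]) (toOp N, τ)
    (by simp [Prod.norm_def, hN, hτ])
  simpa [dist_eq_norm, Prod.norm_def, e] using this

/-- At `τ = ψ_j` the determinant for `M` vanishes and the one for `N` is `∏ (ψ_j - χ_k)`. By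
nearness and the gap every factor with `k ≠ j` is at least `d / 2`, so the remaining factor is
controlled by the difference of determinants. -/
theorem root_sub_le {M N : Matrix (Fin m) (Fin m) ℂ} {ψ χ : Fin m → ℝ} (hM : HasRoots M ψ)
    (hN : HasRoots N χ) {d D : ℝ} (hd : 0 < d) (hgap : ∀ j k, j ≠ k → d ≤ |χ j - χ k|)
    (hnear : ∀ j, |ψ j - χ j| ≤ d / 2) (j : Fin m)
    (hdet : ‖((ψ j : ℂ) • (1 : Matrix (Fin m) (Fin m) ℂ) - M).det -
      ((ψ j : ℂ) • (1 : Matrix (Fin m) (Fin m) ℂ) - N).det‖ ≤ D) :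
    |ψ j - χ j| ≤ ((d / 2) ^ (m - 1))⁻¹ * D := by
  have h0 : ((ψ j : ℂ) • (1 : Matrix (Fin m) (Fin m) ℂ) - M).det = 0 := by
    rw [hM]; exact Finset.prod_eq_zero (Finset.mem_univ j) (sub_self _)
  rw [h0, hN, zero_sub, norm_neg, norm_prod,
    ← Finset.mul_prod_erase Finset.univ _ (Finset.mem_univ j)] at hdet
  have h1 : (d / 2) ^ (m - 1) ≤ ∏ k ∈ Finset.univ.erase j, ‖(ψ j : ℂ) - χ k‖ := by
    have : (Finset.univ.erase j).card = m - 1 := by simp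
    rw [← this, ← Finset.prod_const]
    refine Finset.prod_le_prod (fun _ _ => by positivity) fun k hk => ?_
    rw [← Complex.ofReal_sub, Complex.norm_real, Real.norm_eq_abs]
    have h1 := hgap j k (Finset.ne_of_mem_erase hk).symm
    have h2 := abs_sub_le (χ j) (ψ j) (χ k)
    have h3 := hnear j
    rw [abs_sub_comm] at h3
    linarith
  have h2 : ‖(ψ j : ℂ) - χ j‖ = |ψ j - χ j| := by
    rw [← Complex.ofReal_sub, Complex.norm_real, Real.norm_eq_abs]
  rw [h2] at hdet
  rw [← div_eq_inv_mul, le_div_iff₀ (by positivity)]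
  exact (mul_le_mul_of_nonneg_left h1 (abs_nonneg _)).trans hdet

theorem aeval_basisDivisor (B : Op m) (x y : ℂ) :
    Polynomial.aeval B (Lagrange.basisDivisor x y) = (x - y)⁻¹ • (B - y • 1) := by
  simp [Lagrange.basisDivisor, Algebra.algebraMap_eq_smul_one]

theorem norm_factor_le {B : Op m} {x y d R : ℝ} (hd : 0 < d) (hgap : d ≤ |x - y|)
    (hB : ‖B‖ ≤ R) (hy : |y| ≤ R) :
    ‖((x : ℂ) - y)⁻¹ • (B - (y : ℂ) • (1 : Op m))‖ ≤ max 1 (d⁻¹ * (2 * R)) := by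
  refine le_trans ?_ (le_max_right _ _)
  have hR : 0 ≤ R := (norm_nonneg _).trans hB
  rw [norm_smul, norm_inv, ← Complex.ofReal_sub, Complex.norm_real, Real.norm_eq_abs]
  have h1 : ‖(y : ℂ) • (1 : Op m)‖ ≤ R := by
    rw [norm_smul, Complex.norm_real, Real.norm_eq_abs]
    calc |y| * ‖(1 : Op m)‖ ≤ |y| * 1 := by gcongr; exact op_norm_one_le
      _ ≤ R := by simpa
  gcongr
  exact (norm_sub_le _ _).trans (by linarith)

theorem norm_factor_sub_le {B B' : Op m} {x y x' y' d R δ ε : ℝ} (hd : 0 < d)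
    (hgap : d ≤ |x - y|) (hgap' : d ≤ |x' - y'|) (hB : ‖B‖ ≤ R) (hy : |y| ≤ R)
    (hBB : ‖B - B'‖ ≤ δ) (hx : |x - x'| ≤ ε) (hyy : |y - y'| ≤ ε) :
    ‖((x : ℂ) - y)⁻¹ • (B - (y : ℂ) • (1 : Op m)) -
      ((x' : ℂ) - y')⁻¹ • (B' - (y' : ℂ) • (1 : Op m))‖ ≤
      (d ^ 2)⁻¹ * (2 * ε) * (2 * R) + d⁻¹ * (δ + ε) := by
  have hR : 0 ≤ R := (norm_nonneg _).trans hB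
  have hε : 0 ≤ ε := (abs_nonneg _).trans hx
  have hne : x - y ≠ 0 := fun h => by rw [h, abs_zero] at hgap; linarith
  have hne' : x' - y' ≠ 0 := fun h => by rw [h, abs_zero] at hgap'; linarith
  have hsm : ∀ z : ℝ, ‖(z : ℂ) • (1 : Op m)‖ ≤ |z| := fun z => by
    rw [norm_smul, Complex.norm_real, Real.norm_eq_abs]
    exact mul_le_of_le_one_right (abs_nonneg _) op_norm_one_le
  -- Change the scalar factor first, keeping `B - y`, and then the operator factor.
  have e : ((x : ℂ) - y)⁻¹ • (B - (y : ℂ) • (1 : Op m)) -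
      ((x' : ℂ) - y')⁻¹ • (B' - (y' : ℂ) • (1 : Op m)) =
      (((x - y)⁻¹ - (x' - y')⁻¹ : ℝ) : ℂ) • (B - (y : ℂ) • (1 : Op m)) +
      (((x' - y')⁻¹ : ℝ) : ℂ) • ((B - B') - ((y - y' : ℝ) : ℂ) • (1 : Op m)) := by
    push_cast
    module
  rw [e]
  refine (norm_add_le _ _).trans (add_le_add ?_ ?_)
  · rw [norm_smul, Complex.norm_real, Real.norm_eq_abs]
    refine mul_le_mul ?_ ?_ (norm_nonneg _) (by positivity)
    · rw [inv_sub_inv hne hne', abs_div, abs_mul, div_eq_inv_mul]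
      gcongr
      · rw [pow_two]; gcongr
      · have : x' - y' - (x - y) = (y - y') - (x - x') := by ring
        rw [this]
        exact (abs_sub _ _).trans (by linarith)
    · exact (norm_sub_le _ _).trans (by linarith [hsm y])
  · rw [norm_smul, Complex.norm_real, Real.norm_eq_abs, abs_inv]
    gcongr
    exact (norm_sub_le _ _).trans (add_le_add hBB ((hsm _).trans hyy))

theorem norm_aeval_prod_le {s : Finset (Fin m)} {B : Op m} {f : Fin m → Polynomial ℂ} {q : ℝ}
    (hq : 0 ≤ q) (h : ∀ k ∈ s, ‖Polynomial.aeval B (f k)‖ ≤ q) :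
    ‖Polynomial.aeval B (∏ k ∈ s, f k)‖ ≤ q ^ s.card := by
  induction s using Finset.induction_on with
  | empty => simpa using op_norm_one_le
  | insert a s ha ih =>
    rw [Finset.prod_insert ha, map_mul, Finset.card_insert_of_notMem ha, pow_succ']
    refine (norm_mul_le _ _).trans (mul_le_mul (h a (Finset.mem_insert_self _ _))
      (ih fun k hk => h k (Finset.mem_insert_of_mem hk)) (norm_nonneg _) hq)

/-- Telescoping `XY - X'Y' = X(Y - Y') + (X - X')Y'` over the factors. Taking `q ≥ 1` allows a
missing factor `q` to be inserted, which gives the uniform power `q ^ s.card`. -/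
theorem norm_aeval_prod_sub_le {s : Finset (Fin m)} {B B' : Op m} {f f' : Fin m → Polynomial ℂ}
    {q η : ℝ} (hq : 1 ≤ q) (h : ∀ k ∈ s, ‖Polynomial.aeval B (f k)‖ ≤ q)
    (h' : ∀ k ∈ s, ‖Polynomial.aeval B' (f' k)‖ ≤ q)
    (hη : ∀ k ∈ s, ‖Polynomial.aeval B (f k) - Polynomial.aeval B' (f' k)‖ ≤ η) (hη0 : 0 ≤ η) :
    ‖Polynomial.aeval B (∏ k ∈ s, f k) - Polynomial.aeval B' (∏ k ∈ s, f' k)‖ ≤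
      s.card * q ^ s.card * η := by
  have hq0 : 0 ≤ q := zero_le_one.trans hq
  induction s using Finset.induction_on with
  | empty => simp
  | insert a s ha ih =>
    have hs : ∀ k ∈ s, k ∈ insert a s := fun k hk => Finset.mem_insert_of_mem hk
    have ih' := ih (fun k hk => h k (hs k hk)) (fun k hk => h' k (hs k hk))
      (fun k hk => hη k (hs k hk))
    have hb := norm_aeval_prod_le hq0 fun k hk => h' k (hs k hk)
    have ha1 := h a (Finset.mem_insert_self _ _)
    have ha2 := hη a (Finset.mem_insert_self _ _)
    rw [Finset.prod_insert ha, Finset.prod_insert ha, map_mul, map_mul,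
      Finset.card_insert_of_notMem ha]
    set X := Polynomial.aeval B (f a)
    set X' := Polynomial.aeval B' (f' a)
    set Y := Polynomial.aeval B (∏ k ∈ s, f k)
    set Y' := Polynomial.aeval B' (∏ k ∈ s, f' k)
    have e : X * Y - X' * Y' = X * (Y - Y') + (X - X') * Y' := by
      rw [mul_sub, sub_mul]; abel
    rw [e]
    have hqs : 0 ≤ q ^ s.card := pow_nonneg hq0 _
    calc ‖X * (Y - Y') + (X - X') * Y'‖ ≤ ‖X‖ * ‖Y - Y'‖ + ‖X - X'‖ * ‖Y'‖ :=
          (norm_add_le _ _).trans (add_le_add (norm_mul_le _ _) (norm_mul_le _ _))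
      _ ≤ q * (s.card * q ^ s.card * η) + η * q ^ s.card := by gcongr
      _ ≤ q * (s.card * q ^ s.card * η) + q * (η * q ^ s.card) := by
          exact add_le_add le_rfl (le_mul_of_one_le_left (by positivity) hq)
      _ = _ := by push_cast; ring

theorem norm_specProj_le {B : Op m} {ψ : Fin m → ℝ} {d R : ℝ} (hd : 0 < d)
    (hgap : ∀ j k, j ≠ k → d ≤ |ψ j - ψ k|) (hB : ‖B‖ ≤ R) (hψ : ∀ j, |ψ j| ≤ R) (j : Fin m) :
    ‖specProj B ψ j‖ ≤ max 1 (d⁻¹ * (2 * R)) ^ (m - 1) := by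
  have := norm_aeval_prod_le (s := Finset.univ.erase j) (B := B)
    (f := fun k => Lagrange.basisDivisor (ψ j : ℂ) (ψ k)) (q := max 1 (d⁻¹ * (2 * R)))
    (by positivity) fun k hk => by
      rw [aeval_basisDivisor]
      exact norm_factor_le hd (hgap j k (Finset.ne_of_mem_erase hk).symm) hB (hψ k)
  simpa [specProj, Lagrange.basis] using this

theorem norm_specProj_sub_le {B B' : Op m} {ψ ψ' : Fin m → ℝ} {d R ℓ : ℝ} (hd : 0 < d)
    (hgap : ∀ j k, j ≠ k → d ≤ |ψ j - ψ k|) (hgap' : ∀ j k, j ≠ k → d ≤ |ψ' j - ψ' k|)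
    (hB : ‖B‖ ≤ R) (hB' : ‖B'‖ ≤ R) (hψ : ∀ j, |ψ j| ≤ R) (hψ' : ∀ j, |ψ' j| ≤ R)
    (hℓ : 0 ≤ ℓ) (hψψ : ∀ j, |ψ j - ψ' j| ≤ ℓ * ‖B - B'‖) (j : Fin m) :
    ‖specProj B ψ j - specProj B' ψ' j‖ ≤ (m - 1 : ℕ) * max 1 (d⁻¹ * (2 * R)) ^ (m - 1) *
      ((d ^ 2)⁻¹ * (2 * ℓ) * (2 * R) + d⁻¹ * (1 + ℓ)) * ‖B - B'‖ := by
  have hR : 0 ≤ R := (norm_nonneg _).trans hB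
  have := norm_aeval_prod_sub_le (s := Finset.univ.erase j) (B := B) (B' := B')
    (f := fun k => Lagrange.basisDivisor (ψ j : ℂ) (ψ k))
    (f' := fun k => Lagrange.basisDivisor (ψ' j : ℂ) (ψ' k)) (q := max 1 (d⁻¹ * (2 * R)))
    (η := (d ^ 2)⁻¹ * (2 * (ℓ * ‖B - B'‖)) * (2 * R) + d⁻¹ * (‖B - B'‖ + ℓ * ‖B - B'‖))
    (le_max_left _ _)
    (fun k hk => by
      rw [aeval_basisDivisor]
      exact norm_factor_le hd (hgap j k (Finset.ne_of_mem_erase hk).symm) hB (hψ k))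
    (fun k hk => by
      rw [aeval_basisDivisor]
      exact norm_factor_le hd (hgap' j k (Finset.ne_of_mem_erase hk).symm) hB' (hψ' k))
    (fun k hk => by
      rw [aeval_basisDivisor, aeval_basisDivisor]
      have hjk := (Finset.ne_of_mem_erase hk).symm
      exact norm_factor_sub_le hd (hgap j k hjk) (hgap' j k hjk) hB (hψ k) le_rfl
        (hψψ j) (hψψ k)) (by positivity)
  rw [show (Finset.univ.erase j).card = m - 1 by simp] at this
  refine this.trans_eq ?_
  ring

theorem tendsto_specProj {ι : Type*} {l : Filter ι} {B : ι → Op m} {B₀ : Op m}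
    {ψ : ι → Fin m → ℝ} {ψ₀ : Fin m → ℝ} (hψ₀ : Function.Injective ψ₀)
    (hB : Tendsto B l (𝓝 B₀)) (hψ : ∀ j, Tendsto (fun t => ψ t j) l (𝓝 (ψ₀ j))) (j : Fin m) :
    Tendsto (fun t => specProj (B t) (ψ t) j) l (𝓝 (specProj B₀ ψ₀ j)) := by
  have hc : ∀ k, Tendsto (fun t => (ψ t k : ℂ)) l (𝓝 (ψ₀ k)) := fun k =>
    (Complex.continuous_ofReal.tendsto _).comp (hψ k)
  have key : ∀ s : Finset (Fin m), j ∉ s → Tendsto (fun t => Polynomial.aeval (B t)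
      (∏ k ∈ s, Lagrange.basisDivisor (ψ t j : ℂ) (ψ t k))) l
      (𝓝 (Polynomial.aeval B₀ (∏ k ∈ s, Lagrange.basisDivisor (ψ₀ j : ℂ) (ψ₀ k)))) := by
    intro s
    induction s using Finset.induction_on with
    | empty => intro _; simpa using tendsto_const_nhds
    | insert a s ha ih =>
      intro hj
      simp only [Finset.prod_insert ha, map_mul, aeval_basisDivisor]
      refine Tendsto.mul (Tendsto.smul (Tendsto.inv₀ ((hc j).sub (hc a)) ?_)
        (hB.sub ((hc a).smul_const 1))) (ih fun h => hj (Finset.mem_insert_of_mem h))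
      rw [← Complex.ofReal_sub, Complex.ofReal_ne_zero, sub_ne_zero]
      exact fun h => hj (Finset.mem_insert.2 (Or.inl (hψ₀ h)))
  exact key (Finset.univ.erase j) (Finset.notMem_erase _ _)

end HypSys

/-! ### The ordinary differential equation at a fixed frequency. -/

namespace HypSys

/-- A locally Lipschitz path of matrices with real, uniformly separated characteristic roots and
integrable derivative. -/
structure HyperbolicPath {m : ℕ} (M : ℝ → Matrix (Fin m) (Fin m) ℂ) (ψ : ℝ → Fin m → ℝ)
    (α : ℝ → ℝ) (R d J : ℝ) : Prop where
  lip : LocallyLipschitz (fun t => toOp (M t))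
  bound : ∀ t, ‖toOp (M t)‖ ≤ R
  deriv_le : ∀ᵐ t, ‖deriv (fun t => toOp (M t)) t‖ ≤ α t
  nonneg : ∀ t, 0 ≤ α t
  integrable : Integrable α
  integral_le : ∫ t, α t ≤ J
  roots : ∀ t, HasRoots (M t) (ψ t)
  cont : ∀ j, Continuous (fun t => ψ t j)
  d_pos : 0 < d
  gap : ∀ t j k, j ≠ k → d ≤ |ψ t j - ψ t k|

variable {m : ℕ} {M : ℝ → Matrix (Fin m) (Fin m) ℂ} {ψ : ℝ → Fin m → ℝ} {α : ℝ → ℝ} {R d J : ℝ}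

theorem injective_of_gap {χ : Fin m → ℝ} (hd : 0 < d) (h : ∀ j k, j ≠ k → d ≤ |χ j - χ k|) :
    Function.Injective χ := by
  intro j k hjk
  by_contra hne
  have := h j k hne
  rw [hjk, sub_self, abs_zero] at this
  linarith

/-- Continuity of the labelling keeps equally labelled roots close near `x`, so `root_sub_le`
applies. The neighbourhood depends on the path, but `L` does not. -/
theorem exists_root_lipschitz (m : ℕ) (R d : ℝ) (hd : 0 < d) : ∃ L : ℝ, 0 ≤ L ∧
    ∀ (M : ℝ → Matrix (Fin m) (Fin m) ℂ) (ψ : ℝ → Fin m → ℝ) (α : ℝ → ℝ) (J : ℝ),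
      HyperbolicPath M ψ α R d J → ∀ x, ∃ s ∈ 𝓝 x, ∀ u ∈ s, ∀ v ∈ s, ∀ j,
        |ψ u j - ψ v j| ≤ L * ‖toOp (M u) - toOp (M v)‖ := by
  obtain ⟨L, hL0, hL⟩ := exists_det_lipschitz m R
  refine ⟨((d / 2) ^ (m - 1))⁻¹ * L, by positivity, fun M ψ α J h x => ?_⟩
  -- Two points within `d / 4` of `ψ x j` are within `d / 2` of each other, as `root_sub_le`
  -- requires.
  refine ⟨{t | ∀ j, |ψ t j - ψ x j| < d / 4}, ?_, ?_⟩
  · have : ∀ᶠ t in 𝓝 x, ∀ j, |ψ t j - ψ x j| < d / 4 := by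
      refine eventually_all.2 fun j => ?_
      have := ((h.cont j).tendsto x).eventually (Metric.ball_mem_nhds (ψ x j) (by linarith : 0 < d / 4))
      simpa [Real.dist_eq] using this
    exact this
  · intro u hu v hv j
    rw [mul_assoc]
    refine root_sub_le (h.roots u) (h.roots v) hd (h.gap v) (fun k => ?_) j
      (hL _ _ _ (h.bound u) (h.bound v) ?_)
    · have h1 := hu k
      have h2 := hv k
      have h3 := abs_sub_le (ψ u k) (ψ x k) (ψ v k)
      rw [abs_sub_comm (ψ x k)] at h3
      linarith
    · rw [Complex.norm_real, Real.norm_eq_abs]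
      exact (abs_root_le_norm (h.roots u) j).trans (h.bound u)

/-- The comparison is with increments of the matrix path rather than of time, so that the
derivatives of the projections inherit the integrable bound `α`. -/
theorem exists_specProj_lipschitz (m : ℕ) (R d : ℝ) (hd : 0 < d) : ∃ L : NNReal,
    ∀ (M : ℝ → Matrix (Fin m) (Fin m) ℂ) (ψ : ℝ → Fin m → ℝ) (α : ℝ → ℝ) (J : ℝ),
      HyperbolicPath M ψ α R d J → ∀ j x, ∃ s ∈ 𝓝 x, ∀ u ∈ s, ∀ v ∈ s,
        dist (specProj (toOp (M u)) (ψ u) j) (specProj (toOp (M v)) (ψ v) j) ≤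
          L * dist (toOp (M u)) (toOp (M v)) := by
  obtain ⟨ℓ, hℓ0, hℓ⟩ := exists_root_lipschitz m R d hd
  refine ⟨((m - 1 : ℕ) * max 1 (d⁻¹ * (2 * R)) ^ (m - 1) *
      ((d ^ 2)⁻¹ * (2 * ℓ) * (2 * R) + d⁻¹ * (1 + ℓ))).toNNReal, fun M ψ α J h j x => ?_⟩
  obtain ⟨s, hs, hsl⟩ := hℓ M ψ α J h x
  refine ⟨s, hs, fun u hu v hv => ?_⟩
  have hb : ∀ t j, |ψ t j| ≤ R := fun t j => (abs_root_le_norm (h.roots t) j).trans (h.bound t)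
  rw [dist_eq_norm, dist_eq_norm]
  refine (norm_specProj_sub_le hd (h.gap u) (h.gap v) (h.bound u) (h.bound v) (hb u) (hb v) hℓ0
    (hsl u hu v hv) j).trans ?_
  gcongr
  exact Real.le_coe_toNNReal _

theorem norm_deriv_le_of_dist_le {E F : Type*} [NormedAddCommGroup E] [NormedSpace ℝ E]
    [NormedAddCommGroup F] [NormedSpace ℝ F] {f : ℝ → E} {g : ℝ → F} {x : ℝ} {L : NNReal}
    {s : Set ℝ} (hs : s ∈ 𝓝 x)
    (h : ∀ u ∈ s, ∀ v ∈ s, dist (f u) (f v) ≤ L * dist (g u) (g v))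
    (hf : DifferentiableAt ℝ f x) (hg : DifferentiableAt ℝ g x) :
    ‖deriv f x‖ ≤ L * ‖deriv g x‖ := by
  refine le_of_tendsto_of_tendsto hf.hasDerivAt.tendsto_slope.norm
    (hg.hasDerivAt.tendsto_slope.norm.const_mul (L : ℝ)) ?_
  filter_upwards [mem_nhdsWithin_of_mem_nhds hs] with y hy
  simp only [slope, vsub_eq_sub, norm_smul]
  have := h y hy x (mem_of_mem_nhds hs)
  rw [dist_eq_norm, dist_eq_norm] at this
  calc ‖(y - x)⁻¹‖ * ‖f y - f x‖ ≤ ‖(y - x)⁻¹‖ * (L * ‖g y - g x‖) := by gcongr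
    _ = _ := by ring

/-- The spectral components of a solution, with their phases removed. -/
noncomputable def profile (M : ℝ → Matrix (Fin m) (Fin m) ℂ) (ψ : ℝ → Fin m → ℝ) (r : ℝ)
    (U : ℝ → Cm m) (j : Fin m) (t : ℝ) : Cm m :=
  Complex.exp (-(Complex.I * r * (∫ s in (0 : ℝ)..t, ψ s j : ℝ))) •
    specProj (toOp (M t)) (ψ t) j (U t)

theorem hasDerivAt_phase {ψ : ℝ → ℝ} (hψ : Continuous ψ) (r t : ℝ) :
    HasDerivAt (fun t : ℝ => Complex.exp (-(Complex.I * r * (∫ s in (0 : ℝ)..t, ψ s : ℝ))))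
      (Complex.exp (-(Complex.I * r * (∫ s in (0 : ℝ)..t, ψ s : ℝ))) *
        (-(Complex.I * r * (ψ t : ℂ)))) t := by
  have h1 : HasDerivAt (fun t => ∫ s in (0 : ℝ)..t, ψ s) (ψ t) t :=
    intervalIntegral.integral_hasDerivAt_right (hψ.intervalIntegrable _ _)
      (hψ.stronglyMeasurableAtFilter _ _) hψ.continuousAt
  exact ((h1.ofReal_comp.const_mul (Complex.I * r)).neg).cexp

theorem norm_phase (r x : ℝ) : ‖Complex.exp (-(Complex.I * r * (x : ℂ)))‖ = 1 := by
  have : -(Complex.I * r * (x : ℂ)) = ((-(r * x) : ℝ) : ℂ) * Complex.I := by push_cast; ring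
  rw [this, Complex.norm_exp_ofReal_mul_I]

theorem norm_profile (r : ℝ) (U : ℝ → Cm m) (j : Fin m) (t : ℝ) :
    ‖profile M ψ r U j t‖ = ‖specProj (toOp (M t)) (ψ t) j (U t)‖ := by
  rw [profile, norm_smul, norm_phase, one_mul]

theorem contDiff_phase {ψ : ℝ → ℝ} (hψ : Continuous ψ) (r : ℝ) :
    ContDiff ℝ 1 (fun t : ℝ => Complex.exp (-(Complex.I * r * (∫ s in (0 : ℝ)..t, ψ s : ℝ)))) := by
  have hd := fun t => hasDerivAt_phase hψ r t
  refine contDiff_one_iff_deriv.2 ⟨fun t => (hd t).differentiableAt, ?_⟩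
  rw [funext fun t => (hd t).deriv]
  have hc : Continuous (fun t : ℝ =>
      Complex.exp (-(Complex.I * r * (∫ s in (0 : ℝ)..t, ψ s : ℝ)))) :=
    continuous_iff_continuousAt.2 fun t => (hd t).continuousAt
  exact hc.mul (by fun_prop)

section Solution

variable {r : ℝ} {U : ℝ → Cm m}

theorem contDiff_solution (h : HyperbolicPath M ψ α R d J)
    (hU : ∀ t, HasDerivAt U ((Complex.I * r) • toOp (M t) (U t)) t) : ContDiff ℝ 1 U := by
  refine contDiff_one_iff_deriv.2 ⟨fun t => (hU t).differentiableAt, ?_⟩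
  rw [funext fun t => (hU t).deriv]
  have hc : Continuous U := continuous_iff_continuousAt.2 fun t => (hU t).continuousAt
  exact Continuous.const_smul (h.lip.continuous.clm_apply hc) (Complex.I * (r : ℂ))

theorem locallyLipschitz_specProj (h : HyperbolicPath M ψ α R d J) (j : Fin m) :
    LocallyLipschitz (fun t => specProj (toOp (M t)) (ψ t) j) := by
  obtain ⟨L, hL⟩ := exists_specProj_lipschitz m R d h.d_pos
  exact locallyLipschitz_of_dist_le h.lip fun x =>
    ⟨L, (hL M ψ α J h j x).imp fun s hs => hs⟩

/-- Products of locally Lipschitz maps are handled by composing with this smooth map. -/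
theorem contDiff_smul_apply : ContDiff ℝ 1 (fun p : ℂ × Op m × Cm m => p.1 • p.2.1 p.2.2) := by
  let ρ : Op m →L[ℝ] (Cm m →L[ℝ] Cm m) :=
    ContinuousLinearMap.restrictScalarsL ℂ (Cm m) (Cm m) ℝ ℝ
  have h : ContDiff ℝ 1 (fun p : ℂ × Op m × Cm m => ρ p.2.1 p.2.2) :=
    ContDiff.clm_apply (ρ.contDiff.comp (contDiff_fst.comp contDiff_snd))
      (contDiff_snd.comp contDiff_snd)
  exact contDiff_fst.smul h

theorem locallyLipschitz_profile (h : HyperbolicPath M ψ α R d J)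
    (hU : ∀ t, HasDerivAt U ((Complex.I * r) • toOp (M t) (U t)) t) (j : Fin m) :
    LocallyLipschitz (profile M ψ r U j) := by
  have h1 := (contDiff_phase (h.cont j) r).locallyLipschitz
  have h2 := (contDiff_solution h hU).locallyLipschitz
  have h3 := locallyLipschitz_specProj h j
  have h4 := (contDiff_smul_apply (m := m)).locallyLipschitz.comp (h1.prodMk (h3.prodMk h2))
  exact h4

/-- Differentiating the phase gives `-i r ψ_j P_j U`, and the equation gives `P_j (i r M U) = i r
ψ_j P_j U`. They cancel, and what is left has no factor `r` outside the unimodular phase; this is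
the source of uniformity in frequency. -/
theorem hasDerivAt_profile (h : HyperbolicPath M ψ α R d J)
    (hU : ∀ t, HasDerivAt U ((Complex.I * r) • toOp (M t) (U t)) t) (j : Fin m) {t : ℝ}
    (hP : DifferentiableAt ℝ (fun t => specProj (toOp (M t)) (ψ t) j) t) :
    HasDerivAt (profile M ψ r U j)
      (Complex.exp (-(Complex.I * r * (∫ s in (0 : ℝ)..t, ψ s j : ℝ))) •
        (deriv (fun t => specProj (toOp (M t)) (ψ t) j) t) (U t)) t := by
  have hPU : HasDerivAt (fun t => specProj (toOp (M t)) (ψ t) j (U t))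
      ((deriv (fun t => specProj (toOp (M t)) (ψ t) j) t) (U t) +
        specProj (toOp (M t)) (ψ t) j ((Complex.I * r) • toOp (M t) (U t))) t := by
    let ρ : Op m →L[ℝ] (Cm m →L[ℝ] Cm m) :=
      ContinuousLinearMap.restrictScalarsL ℂ (Cm m) (Cm m) ℝ ℝ
    have := (ρ.hasFDerivAt.comp_hasDerivAt t hP.hasDerivAt).clm_apply (hU t)
    exact this
  have hp := hasDerivAt_phase (h.cont j) r t
  have hfin := hp.smul hPU
  have hcomm : specProj (toOp (M t)) (ψ t) j (toOp (M t) (U t)) =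
      (ψ t j : ℂ) • specProj (toOp (M t)) (ψ t) j (U t) := by
    have := congrArg (fun T : Op m => T (U t)) (specProj_mul (h.roots t) j)
    simpa using this
  refine hfin.congr_deriv ?_
  rw [map_smul, hcomm]
  module

/-- The projections sum to the identity and the phases have modulus one. -/
theorem norm_le_sum_profile (h : HyperbolicPath M ψ α R d J) (t : ℝ) :
    ‖U t‖ ≤ ∑ j, ‖profile M ψ r U j t‖ := by
  have h1 := congrArg (fun T : Op m => T (U t))
    (sum_specProj (B := toOp (M t)) (injective_of_gap h.d_pos (h.gap t)))
  simp only [sum_apply, one_apply_eq_self] at h1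
  conv_lhs => rw [← h1]
  simp only [norm_profile]
  exact norm_sum_le _ _

theorem exists_norm_deriv_specProj_le (m : ℕ) (R d : ℝ) (hd : 0 < d) : ∃ L : NNReal,
    ∀ (M : ℝ → Matrix (Fin m) (Fin m) ℂ) (ψ : ℝ → Fin m → ℝ) (α : ℝ → ℝ) (J : ℝ),
      HyperbolicPath M ψ α R d J → ∀ᵐ t, ∀ j,
        DifferentiableAt ℝ (fun t => specProj (toOp (M t)) (ψ t) j) t ∧
        ‖deriv (fun t => specProj (toOp (M t)) (ψ t) j) t‖ ≤ L * α t := by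
  obtain ⟨L, hL⟩ := exists_specProj_lipschitz m R d hd
  refine ⟨L, fun M ψ α J h => ?_⟩
  rw [ae_all_iff]
  intro j
  filter_upwards [ae_differentiableAt_of_locallyLipschitz (locallyLipschitz_specProj h j),
    ae_differentiableAt_of_locallyLipschitz h.lip, h.deriv_le] with t h1 h2 h3
  obtain ⟨s, hs, hsL⟩ := hL M ψ α J h j t
  refine ⟨h1, (norm_deriv_le_of_dist_le hs hsL h1 h2).trans ?_⟩
  gcongr

/-- Uniform energy estimate. -/
theorem exists_norm_solution_le (m : ℕ) (R d J : ℝ) (hd : 0 < d) : ∃ C : ℝ, 0 ≤ C ∧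
    ∀ (M : ℝ → Matrix (Fin m) (Fin m) ℂ) (ψ : ℝ → Fin m → ℝ) (α : ℝ → ℝ),
      HyperbolicPath M ψ α R d J → ∀ (r : ℝ) (U : ℝ → Cm m),
        (∀ t, HasDerivAt U ((Complex.I * r) • toOp (M t) (U t)) t) →
        ∀ s t, ‖U t‖ ≤ C * ‖U s‖ := by
  obtain ⟨L, hL⟩ := exists_norm_deriv_specProj_le m R d hd
  set Q := max 1 (d⁻¹ * (2 * R)) ^ (m - 1) with hQ
  have hQ0 : 0 ≤ Q := by positivity
  -- The outer `m` is Cauchy–Schwarz in `U = ∑ P_j U`, the exponential is Grönwall's factor, and `m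
  -- * Q ^ 2` bounds the initial energy through `‖P_j‖ ≤ Q`. Neither `r` nor the path enters.
  refine ⟨Real.sqrt (m * (Real.exp (2 * L * m * J) * (m * Q ^ 2))), by positivity,
    fun M ψ α h r U hU s t => ?_⟩
  set w := profile M ψ r U with hw
  -- Squares make the energy a smooth function of the profiles, so it is locally Lipschitz and
  -- differentiable wherever they are.
  set N : ℝ → ℝ := fun t => ∑ j, ‖w j t‖ ^ 2 with hN
  have hNlip : LocallyLipschitz N := by
    have hΦ : ContDiff ℝ 1 (fun p : Fin m → Cm m => ∑ j, ‖p j‖ ^ 2) :=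
      ContDiff.sum fun j _ => (contDiff_apply ℝ (Cm m) j).norm_sq ℝ
    refine hΦ.locallyLipschitz.comp (f := fun p : Fin m → Cm m => ∑ j, ‖p j‖ ^ 2)
      (g := fun t j => w j t)
      (locallyLipschitz_pi fun j => locallyLipschitz_profile h hU j)
  have hder : ∀ᵐ x, |deriv N x| ≤ (2 * L * m * α x) * N x := by
    filter_upwards [hL M ψ α J h] with x hx
    have hwd : ∀ j, HasDerivAt (w j) (Complex.exp (-(Complex.I * r * (∫ s in (0 : ℝ)..x, ψ s j : ℝ))) •
        (deriv (fun t => specProj (toOp (M t)) (ψ t) j) x) (U x)) x := fun j =>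
      hasDerivAt_profile h hU j (hx j).1
    set w' : Fin m → Cm m := fun j => Complex.exp (-(Complex.I * r * (∫ s in (0 : ℝ)..x, ψ s j : ℝ))) •
        (deriv (fun t => specProj (toOp (M t)) (ψ t) j) x) (U x) with hw'
    have hw'le : ∀ j, ‖w' j‖ ≤ L * α x * ∑ k, ‖w k x‖ := by
      intro j
      rw [hw', norm_smul, norm_phase, one_mul]
      refine (ContinuousLinearMap.le_opNorm _ _).trans ?_
      have := h.nonneg x
      exact mul_le_mul (hx j).2 (norm_le_sum_profile h x) (norm_nonneg _) (by positivity)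
    have hNd : HasDerivAt N (∑ j, 2 * inner ℝ (w j x) (w' j)) x :=
      HasDerivAt.fun_sum fun j _ => (hwd j).norm_sq
    rw [hNd.deriv]
    have hsq : (∑ k, ‖w k x‖) ^ 2 ≤ m * N x := by
      simpa using sq_sum_le_card_mul_sum_sq (s := (Finset.univ : Finset (Fin m)))
        (f := fun k => ‖w k x‖)
    calc |∑ j, 2 * inner ℝ (w j x) (w' j)| ≤ ∑ j, |2 * inner ℝ (w j x) (w' j)| :=
          Finset.abs_sum_le_sum_abs _ _
      _ ≤ ∑ j, 2 * (‖w j x‖ * (L * α x * ∑ k, ‖w k x‖)) := by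
          refine Finset.sum_le_sum fun j _ => ?_
          rw [abs_mul, abs_two]
          gcongr
          exact (abs_real_inner_le_norm _ _).trans (by gcongr; exact hw'le j)
      _ = 2 * L * α x * (∑ k, ‖w k x‖) ^ 2 := by
          rw [← Finset.mul_sum, ← Finset.sum_mul]; ring
      _ ≤ 2 * L * α x * (m * N x) := by
          have := h.nonneg x
          gcongr
      _ = _ := by ring
  have hgr := le_exp_integral_mul_of_abs_deriv_le hNlip
    (fun x => Finset.sum_nonneg fun j _ => by positivity) (h.integrable.const_mul (2 * L * m)) hder
    (fun x => by have := h.nonneg x; positivity) s t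
  rw [integral_const_mul] at hgr
  have hNs : N s ≤ m * Q ^ 2 * ‖U s‖ ^ 2 := by
    calc N s ≤ ∑ _j : Fin m, (Q * ‖U s‖) ^ 2 := by
          refine Finset.sum_le_sum fun j _ => ?_
          gcongr
          rw [hw, norm_profile]
          refine (ContinuousLinearMap.le_opNorm _ _).trans ?_
          gcongr
          exact norm_specProj_le h.d_pos (h.gap s) (h.bound s)
            (fun k => (abs_root_le_norm (h.roots s) k).trans (h.bound s)) j
      _ = _ := by simp; ring
  have hUt : ‖U t‖ ^ 2 ≤ m * N t := by
    refine (pow_le_pow_left₀ (norm_nonneg _) (norm_le_sum_profile (r := r) h t) 2).trans ?_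
    simpa using sq_sum_le_card_mul_sum_sq (s := (Finset.univ : Finset (Fin m)))
      (f := fun k => ‖w k t‖)
  have hexp : Real.exp (2 * L * m * ∫ x, α x) ≤ Real.exp (2 * L * m * J) := by
    have := h.integral_le
    gcongr
  have hfin : ‖U t‖ ^ 2 ≤ (m * (Real.exp (2 * L * m * J) * (m * Q ^ 2))) * ‖U s‖ ^ 2 := by
    calc ‖U t‖ ^ 2 ≤ m * N t := hUt
      _ ≤ m * (Real.exp (2 * L * m * J) * (m * Q ^ 2 * ‖U s‖ ^ 2)) := by
          gcongr
          refine hgr.trans (mul_le_mul hexp hNs (Finset.sum_nonneg fun j _ => by positivity)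
            (by positivity))
      _ = _ := by ring
  rw [← Real.sqrt_sq (norm_nonneg (U t)), ← Real.sqrt_sq (norm_nonneg (U s)),
    ← Real.sqrt_mul (by positivity)]
  exact Real.sqrt_le_sqrt hfin

/-- By the energy estimate `U` is bounded, so the derivative of the profile is dominated by a
multiple of `α`. -/
theorem exists_tendsto_profile (h : HyperbolicPath M ψ α R d J)
    (hU : ∀ t, HasDerivAt U ((Complex.I * r) • toOp (M t) (U t)) t) (j : Fin m) {l : Filter ℝ}
    (hl : l = atTop ∨ l = atBot) : ∃ v, Tendsto (profile M ψ r U j) l (𝓝 v) := by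
  obtain ⟨L, hL⟩ := exists_norm_deriv_specProj_le m R d h.d_pos
  obtain ⟨C, -, hC⟩ := exists_norm_solution_le m R d J h.d_pos
  refine exists_tendsto_of_integrable_deriv (locallyLipschitz_profile h hU j)
    (β := fun t => L * α t * (C * ‖U 0‖)) ((h.integrable.const_mul _).mul_const _) ?_ hl
  filter_upwards [hL M ψ α J h] with t ht
  rw [(hasDerivAt_profile h hU j (ht j).1).deriv, norm_smul, norm_phase, one_mul]
  refine (ContinuousLinearMap.le_opNorm _ _).trans ?_
  have := h.nonneg t
  exact mul_le_mul (ht j).2 (hC M ψ α h r U hU 0 t) (norm_nonneg _) (by positivity)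

/-- The backward free propagator acts on a spectral subspace by a phase. -/
theorem propagator_mul_specProj {N : Matrix (Fin m) (Fin m) ℂ} {χ : Fin m → ℝ}
    (hN : HasRoots N χ) {G : ℝ → Op m} (hG0 : G 0 = 1)
    (hG : ∀ t, HasDerivAt G (-((Complex.I * r) • (G t * toOp N))) t) (j : Fin m) (t : ℝ) :
    G t * specProj (toOp N) χ j =
      Complex.exp (-(Complex.I * r * (t * χ j : ℝ))) • specProj (toOp N) χ j := by
  set P := specProj (toOp N) χ j with hP
  have hcomm : toOp N * P = (χ j : ℂ) • P := by
    rw [← specProj_mul hN j, hP, specProj]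
    set p := Lagrange.basis Finset.univ (fun k => (χ k : ℂ)) j
    have := Polynomial.aeval_X (R := ℂ) (toOp N)
    calc toOp N * Polynomial.aeval (toOp N) p = Polynomial.aeval (toOp N) (Polynomial.X * p) := by
          rw [map_mul, this]
      _ = Polynomial.aeval (toOp N) p * toOp N := by rw [mul_comm, map_mul, this]
  have hph : ∀ t : ℝ, HasDerivAt (fun t : ℝ => Complex.exp (Complex.I * r * (t * χ j : ℝ)))
      (Complex.exp (Complex.I * r * (t * χ j : ℝ)) * (Complex.I * r * (χ j : ℂ))) t := fun t => by
    have h1 : HasDerivAt (fun t : ℝ => t * χ j) (χ j) t := by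
      simpa using (hasDerivAt_id t).mul_const (χ j)
    exact (h1.ofReal_comp.const_mul (Complex.I * r)).cexp
  have hd : ∀ t, HasDerivAt
      (fun t : ℝ => Complex.exp (Complex.I * r * (t * χ j : ℝ)) • (G t * P)) 0 t := fun t => by
    refine ((hph t).smul ((hG t).mul_const P)).congr_deriv ?_
    have e : -((Complex.I * r) • (G t * toOp N)) * P =
        -((Complex.I * r * (χ j : ℂ)) • (G t * P)) := by
      refine (neg_mul ((Complex.I * r) • (G t * toOp N)) P).trans (congrArg _ ?_)
      rw [smul_mul_assoc, mul_assoc, hcomm, mul_smul_comm, smul_smul]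
    rw [e]
    module
  have hconst := is_const_of_deriv_eq_zero (fun t => (hd t).differentiableAt)
    (fun t => (hd t).deriv) t 0
  simp only [hG0, zero_mul, Complex.ofReal_zero, mul_zero, Complex.exp_zero, one_smul, one_mul]
    at hconst
  conv_rhs => rw [← hconst]
  rw [smul_smul, ← Complex.exp_add, neg_add_cancel, Complex.exp_zero, one_smul]

/-- Existence of the asymptotic profile: undoing the limiting evolution, a solution converges. -/
theorem exists_tendsto_propagator_apply (h : HyperbolicPath M ψ α R d J)
    (hU : ∀ t, HasDerivAt U ((Complex.I * r) • toOp (M t) (U t)) t) {l : Filter ℝ}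
    (hl : l = atTop ∨ l = atBot) {N : Matrix (Fin m) (Fin m) ℂ} {χ : Fin m → ℝ}
    (hN : HasRoots N χ) (hχ : Function.Injective χ)
    (hMN : Tendsto (fun t => toOp (M t)) l (𝓝 (toOp N)))
    (hψχ : ∀ j, Tendsto (fun t => ψ t j) l (𝓝 (χ j)))
    (hstab : ∀ j, ∃ θ : ℝ, Tendsto (fun t => ∫ s in (0 : ℝ)..t, (ψ s j - χ j)) l (𝓝 θ))
    {G : ℝ → Op m} (hG0 : G 0 = 1)
    (hG : ∀ t, HasDerivAt G (-((Complex.I * r) • (G t * toOp N))) t) :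
    ∃ v, Tendsto (fun t => G t (U t)) l (𝓝 v) := by
  obtain ⟨C, -, hC⟩ := exists_norm_solution_le m R d J h.d_pos
  choose v hv using fun j => exists_tendsto_profile h hU j hl
  choose θ hθ using hstab
  -- `G` acts on the limiting spectral subspaces by phases; trading the limiting projection for the
  -- one at time `t` produces the profile, with phase `r ∫₀ᵗ (ψ_j - χ_j)`, plus an error. The first
  -- term converges by stability, and the error vanishes because the projections converge and `U` is
  -- bounded.
  have hsplit : ∀ t, G t (U t) = ∑ j,
      (Complex.exp (Complex.I * r * (∫ s in (0 : ℝ)..t, (ψ s j - χ j) : ℝ)) • profile M ψ r U j t +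
        Complex.exp (-(Complex.I * r * (t * χ j : ℝ))) •
          (specProj (toOp N) χ j - specProj (toOp (M t)) (ψ t) j) (U t)) := by
    intro t
    have h1 : G t (U t) = ∑ j, (G t * specProj (toOp N) χ j) (U t) := by
      rw [← sum_apply, ← Finset.mul_sum, sum_specProj hχ, mul_one]
    rw [h1]
    refine Finset.sum_congr rfl fun j _ => ?_
    rw [propagator_mul_specProj hN hG0 hG, profile, smul_smul, ← Complex.exp_add,
      intervalIntegral.integral_sub ((h.cont j).intervalIntegrable _ _) (by simp),
      intervalIntegral.integral_const, smul_apply,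
      sub_apply, smul_sub]
    have : Complex.I * r * ((∫ s in (0 : ℝ)..t, ψ s j) - (t - 0) • χ j : ℝ) +
        -(Complex.I * r * (∫ s in (0 : ℝ)..t, ψ s j : ℝ)) =
        -(Complex.I * r * (t * χ j : ℝ)) := by
      rw [smul_eq_mul]; push_cast; ring
    rw [this]
    abel
  refine ⟨∑ j, (Complex.exp (Complex.I * r * (θ j : ℂ)) • v j + 0), ?_⟩
  refine (tendsto_finsetSum _ fun j _ => ?_).congr fun t => (hsplit t).symm
  refine Tendsto.add (Tendsto.smul ?_ (hv j)) ?_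
  · exact (Complex.continuous_exp.tendsto _).comp
      (((Complex.continuous_ofReal.tendsto _).comp (hθ j)).const_mul _)
  · have hz : Tendsto (fun t => ‖specProj (toOp N) χ j - specProj (toOp (M t)) (ψ t) j‖ *
        (C * ‖U 0‖)) l (𝓝 0) := by
      have h1 := ((tendsto_specProj hχ hMN hψχ j).const_sub (specProj (toOp N) χ j)).norm
      rw [sub_self, norm_zero] at h1
      simpa using h1.mul_const (C * ‖U 0‖)
    refine squeeze_zero_norm (fun t => ?_) hz
    rw [norm_smul, norm_phase, one_mul]
    refine (ContinuousLinearMap.le_opNorm _ _).trans ?_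
    gcongr
    exact hC M ψ α h r U hU 0 t

end Solution

end HypSys

/-! ### Fundamental solutions as Dyson series, and limits of inverses. -/

namespace HypSys

section Dyson

variable {𝔸 X : Type*} [NormedRing 𝔸] [NormedAlgebra ℝ 𝔸]

/-- The terms of the Dyson series of `E' = a E`, `E(0) = 1`. -/
noncomputable def dysonTerm (a : ℝ → 𝔸) : ℕ → ℝ → 𝔸
  | 0 => fun _ => 1
  | k + 1 => fun t => ∫ s in (0 : ℝ)..t, a s * dysonTerm a k s

/-- The fundamental solution of `E' = a E`, `E(0) = 1`. -/
noncomputable def dyson (a : ℝ → 𝔸) (t : ℝ) : 𝔸 := ∑' k, dysonTerm a k t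

variable {a : ℝ → 𝔸}

theorem continuous_dysonTerm (ha : Continuous a) (k : ℕ) : Continuous (dysonTerm a k) := by
  induction k with
  | zero => exact continuous_const
  | succ k ih =>
    exact intervalIntegral.continuous_primitive
      (fun _ _ => (ha.mul ih).intervalIntegrable _ _) 0

theorem hasDerivAt_dysonTerm_succ [CompleteSpace 𝔸] (ha : Continuous a) (k : ℕ) (t : ℝ) :
    HasDerivAt (dysonTerm a (k + 1)) (a t * dysonTerm a k t) t := by
  have hc := ha.mul (continuous_dysonTerm ha k)
  exact intervalIntegral.integral_hasDerivAt_right (hc.intervalIntegrable _ _)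
    (hc.stronglyMeasurableAtFilter _ _) hc.continuousAt

/-- The factor `|t| ^ k / k!` is the volume of the simplex of ordered times; integrating `|s| ^ k`
repeatedly produces it for either sign of `t`. -/
theorem norm_dysonTerm_le {K : ℝ} (hK : ∀ t, ‖a t‖ ≤ K) (k : ℕ) (t : ℝ) :
    ‖dysonTerm a k t‖ ≤ ‖(1 : 𝔸)‖ * ((K * |t|) ^ k / k.factorial) := by
  have hK0 : 0 ≤ K := (norm_nonneg _).trans (hK 0)
  induction k generalizing t with
  | zero => simp [dysonTerm]
  | succ k ih =>
    have hb : ∀ s, ‖a s * dysonTerm a k s‖ ≤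
        ‖(1 : 𝔸)‖ * K ^ (k + 1) / k.factorial * |s| ^ k := fun s => by
      refine (norm_mul_le _ _).trans ?_
      refine (mul_le_mul (hK s) (ih s) (norm_nonneg _) hK0).trans_eq ?_
      rw [mul_pow]; ring
    have hint : |∫ s in (0 : ℝ)..t, |s| ^ k| = |t| ^ (k + 1) / (k + 1) := by
      rcases le_total 0 t with ht | ht
      · have : ∫ s in (0 : ℝ)..t, |s| ^ k = ∫ s in (0 : ℝ)..t, s ^ k := by
          refine intervalIntegral.integral_congr fun s hs => ?_
          rw [uIcc_of_le ht] at hs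
          simp only [abs_of_nonneg hs.1]
        rw [this, integral_pow, abs_of_nonneg ht]
        simp only [ne_eq, Nat.succ_ne_zero, not_false_eq_true, zero_pow, sub_zero]
        exact abs_of_nonneg (by positivity)
      · have : ∫ s in (0 : ℝ)..t, |s| ^ k = ∫ s in (0 : ℝ)..t, (-s) ^ k := by
          refine intervalIntegral.integral_congr fun s hs => ?_
          rw [uIcc_of_ge ht] at hs
          simp only [abs_of_nonpos hs.2]
        rw [this, intervalIntegral.integral_comp_neg (fun s => s ^ k), integral_pow,
          abs_of_nonpos ht]
        have ht' : 0 ≤ -t := by linarith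
        simp only [neg_zero, ne_eq, Nat.succ_ne_zero, not_false_eq_true, zero_pow, zero_sub]
        rw [neg_div, abs_neg]
        exact abs_of_nonneg (by positivity)
    calc ‖dysonTerm a (k + 1) t‖
        ≤ |∫ s in (0 : ℝ)..t, ‖(1 : 𝔸)‖ * K ^ (k + 1) / k.factorial * |s| ^ k| := by
          refine intervalIntegral.norm_integral_le_abs_of_norm_le (ae_of_all _ fun s => hb s) ?_
          exact Continuous.intervalIntegrable (by fun_prop) _ _
      _ = ‖(1 : 𝔸)‖ * K ^ (k + 1) / k.factorial * (|t| ^ (k + 1) / (k + 1)) := by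
          rw [intervalIntegral.integral_const_mul, abs_mul, hint, abs_of_nonneg (by positivity)]
      _ = _ := by
          rw [Nat.factorial_succ, mul_pow]; push_cast
          field_simp

theorem summable_dysonTerm [CompleteSpace 𝔸] {K : ℝ} (hK : ∀ t, ‖a t‖ ≤ K) (t : ℝ) :
    Summable (fun k => dysonTerm a k t) :=
  Summable.of_norm_bounded ((Real.summable_pow_div_factorial _).mul_left _)
    fun k => norm_dysonTerm_le hK k t

theorem dyson_zero : dyson a 0 = 1 := by
  rw [dyson, tsum_eq_single 0]
  · rfl
  · intro k hk
    obtain ⟨k, rfl⟩ := Nat.exists_eq_succ_of_ne_zero hk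
    simp [dysonTerm]

theorem hasDerivAt_dyson [CompleteSpace 𝔸] (ha : Continuous a) {K : ℝ} (hK : ∀ t, ‖a t‖ ≤ K) (t : ℝ) :
    HasDerivAt (dyson a) (a t * dyson a t) t := by
  have hK0 : 0 ≤ K := (norm_nonneg _).trans (hK 0)
  -- With the constant term split off, each remaining term has derivative `a` times its predecessor,
  -- so the differentiated series sums to `a` times the whole series.
  have hs : dyson a = fun t => 1 + ∑' k, dysonTerm a (k + 1) t := by
    ext t
    rw [dyson, (summable_dysonTerm hK t).tsum_eq_zero_add]
    rfl
  have ht : t ∈ Metric.ball (0 : ℝ) (|t| + 1) := by simp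
  have hb : ∀ (k : ℕ) (y : ℝ), y ∈ Metric.ball (0 : ℝ) (|t| + 1) →
      ‖a y * dysonTerm a k y‖ ≤ K * (‖(1 : 𝔸)‖ * ((K * (|t| + 1)) ^ k / k.factorial)) := by
    intro k y hy
    have hy' : |y| ≤ |t| + 1 := by simpa using (Metric.mem_ball.1 hy).le
    refine (norm_mul_le _ _).trans (mul_le_mul (hK y) ((norm_dysonTerm_le hK k y).trans ?_)
      (norm_nonneg _) hK0)
    gcongr
  have hu : Summable fun k : ℕ => K * (‖(1 : 𝔸)‖ * ((K * (|t| + 1)) ^ k / k.factorial)) :=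
    ((Real.summable_pow_div_factorial _).mul_left _).mul_left _
  have hsum : HasDerivAt (fun t => ∑' k, dysonTerm a (k + 1) t)
      (∑' k, a t * dysonTerm a k t) t :=
    hasDerivAt_tsum_of_isPreconnected (g := fun k => dysonTerm a (k + 1))
      (g' := fun k y => a y * dysonTerm a k y) hu Metric.isOpen_ball
      (convex_ball _ _).isPreconnected (fun k y _ => hasDerivAt_dysonTerm_succ ha k y) hb ht
      ((summable_nat_add_iff 1).2 (summable_dysonTerm hK t)) ht
  rw [(summable_dysonTerm hK t).tsum_mul_left] at hsum
  rw [hs]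
  exact (hsum.const_add 1).congr_deriv (congrArg (a t * ·) (congrFun hs t))

/-- Measurability in the parameter is visible on the explicit iterated integrals: the integrand is
continuous in time and measurable in `x`, hence jointly measurable. -/
theorem stronglyMeasurable_dysonTerm [MeasurableSpace X] {a : ℝ → X → 𝔸}
    (ha : ∀ x, Continuous fun t => a t x) (hm : ∀ t, StronglyMeasurable (a t)) (k : ℕ) (t : ℝ) :
    StronglyMeasurable (fun x => dysonTerm (fun s => a s x) k t) := by
  induction k generalizing t with
  | zero => exact stronglyMeasurable_const
  | succ k ih =>
    have hj : StronglyMeasurable (Function.uncurry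
        fun (s : ℝ) (x : X) => a s x * dysonTerm (fun s => a s x) k s) :=
      stronglyMeasurable_uncurry_of_continuous_of_stronglyMeasurable
        (fun x => (ha x).mul (continuous_dysonTerm (ha x) k)) fun s => (hm s).mul (ih s)
    simp only [dysonTerm, intervalIntegral]
    exact (hj.integral_prod_left' (μ := volume.restrict (Ioc 0 t))).sub
      (hj.integral_prod_left' (μ := volume.restrict (Ioc t 0)))

theorem stronglyMeasurable_dyson [CompleteSpace 𝔸] [MeasurableSpace X] {a : ℝ → X → 𝔸}
    (ha : ∀ x, Continuous fun t => a t x) (hm : ∀ t, StronglyMeasurable (a t))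
    (hK : ∀ x, ∃ K : ℝ, ∀ t, ‖a t x‖ ≤ K) (t : ℝ) :
    StronglyMeasurable (fun x => dyson (fun s => a s x) t) := by
  refine stronglyMeasurable_of_tendsto (u := atTop)
    (f := fun n x => ∑ k ∈ Finset.range n, dysonTerm (fun s => a s x) k t) (fun n => ?_) ?_
  · exact Finset.stronglyMeasurable_fun_sum _ fun k _ => stronglyMeasurable_dysonTerm ha hm k t
  · rw [tendsto_pi_nhds]
    intro x
    obtain ⟨K, hK⟩ := hK x
    exact (summable_dysonTerm hK t).hasSum.tendsto_sum_nat

/-- The inverse of the fundamental solution: the solution of `F' = -F a`, `F(0) = 1`. -/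
noncomputable def dysonInv (a : ℝ → 𝔸) (t : ℝ) : 𝔸 :=
  MulOpposite.unop (dyson (fun s => MulOpposite.op (-a s)) t)

theorem dysonInv_zero : dysonInv a 0 = 1 := by
  rw [dysonInv, dyson_zero, MulOpposite.unop_one]

theorem hasDerivAt_dysonInv [CompleteSpace 𝔸] (ha : Continuous a) {K : ℝ} (hK : ∀ t, ‖a t‖ ≤ K)
    (t : ℝ) : HasDerivAt (dysonInv a) (-(dysonInv a t * a t)) t := by
  -- Reversing the order of multiplication turns `E' = -a E` into `F' = -F a`.
  have hd := hasDerivAt_dyson (a := fun s => MulOpposite.op (-a s))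
    (MulOpposite.continuous_op.comp ha.neg) (K := K)
    (fun t => by rw [MulOpposite.norm_op, norm_neg]; exact hK t) t
  have := ((MulOpposite.opContinuousLinearEquiv ℝ (M := 𝔸)).symm : 𝔸ᵐᵒᵖ →L[ℝ] 𝔸).hasFDerivAt.comp_hasDerivAt
    t hd
  exact this.congr_deriv (mul_neg (dysonInv a t) (a t))

theorem dysonInv_mul_dyson [CompleteSpace 𝔸] (ha : Continuous a) {K : ℝ} (hK : ∀ t, ‖a t‖ ≤ K)
    (t : ℝ) : dysonInv a t * dyson a t = 1 := by
  have hd : ∀ t, HasDerivAt (fun t => dysonInv a t * dyson a t) 0 t := fun t => by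
    refine ((hasDerivAt_dysonInv ha hK t).mul (hasDerivAt_dyson ha hK t)).congr_deriv ?_
    rw [← mul_assoc, neg_mul, neg_add_cancel]
  have := is_const_of_deriv_eq_zero (fun t => (hd t).differentiableAt) (fun t => (hd t).deriv) t 0
  simpa [dysonInv_zero, dyson_zero] using this

theorem stronglyMeasurable_dysonInv [CompleteSpace 𝔸] [MeasurableSpace X] {a : ℝ → X → 𝔸}
    (ha : ∀ x, Continuous fun t => a t x) (hm : ∀ t, StronglyMeasurable (a t))
    (hK : ∀ x, ∃ K : ℝ, ∀ t, ‖a t x‖ ≤ K) (t : ℝ) :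
    StronglyMeasurable (fun x => dysonInv (fun s => a s x) t) :=
  MulOpposite.continuous_unop.comp_stronglyMeasurable
    (stronglyMeasurable_dyson (a := fun s x => MulOpposite.op (-a s x))
      (fun x => MulOpposite.continuous_op.comp (ha x).neg)
      (fun s => MulOpposite.continuous_op.comp_stronglyMeasurable (hm s).neg)
      (fun x => (hK x).imp fun K h t => by rw [MulOpposite.norm_op, norm_neg]; exact h t) t)

end Dyson

variable {m : ℕ}

/-- In finite dimension one-sided inverses are two-sided. -/
theorem op_mul_eq_one_comm {S T : Op m} : S * T = 1 ↔ T * S = 1 := by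
  have key : ∀ S T : Op m, S * T = 1 → T * S = 1 := fun S T h => by
    have h1 : (S : Cm m →ₗ[ℂ] Cm m) * (T : Cm m →ₗ[ℂ] Cm m) = 1 :=
      congrArg (fun A : Op m => (A : Cm m →ₗ[ℂ] Cm m)) h
    have h2 : (T : Cm m →ₗ[ℂ] Cm m) * (S : Cm m →ₗ[ℂ] Cm m) = 1 := mul_eq_one_comm.1 h1
    exact ContinuousLinearMap.coe_injective h2
  exact ⟨key S T, key T S⟩

theorem dyson_mul_dysonInv {a : ℝ → Op m} (ha : Continuous a) {K : ℝ} (hK : ∀ t, ‖a t‖ ≤ K)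
    (t : ℝ) : dyson a t * dysonInv a t = 1 :=
  op_mul_eq_one_comm.1 (dysonInv_mul_dyson ha hK t)

/-- Operators with a limit and uniformly bounded inverses have convergent inverses. -/
theorem exists_tendsto_inverse {ι : Type*} {l : Filter ι} [l.NeBot] {S T : ι → Op m} {S₀ : Op m}
    (hS : Tendsto S l (𝓝 S₀)) {C : ℝ} (hT : ∀ t, ‖T t‖ ≤ C) (hST : ∀ t, S t * T t = 1)
    (hTS : ∀ t, T t * S t = 1) :
    ∃ T₀ : Op m, Tendsto T l (𝓝 T₀) ∧ S₀ * T₀ = 1 ∧ T₀ * S₀ = 1 := by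
  have hC : 0 ≤ C := by
    obtain ⟨t⟩ := l.nonempty_of_neBot
    exact (norm_nonneg _).trans (hT t)
  -- The resolvent-type identity `T_s - T_t = T_s (S_t - S_s) T_t` makes `T` Cauchy when `S` is.
  have hle : ∀ s t, ‖T s - T t‖ ≤ C * C * ‖S s - S t‖ := fun s t => by
    have e : T s - T t = T s * (S t - S s) * T t := by
      rw [mul_sub, sub_mul, mul_assoc, hST, mul_one, hTS, one_mul]
    rw [e, norm_sub_rev (S s)]
    calc ‖T s * (S t - S s) * T t‖ ≤ ‖T s‖ * ‖S t - S s‖ * ‖T t‖ :=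
          (norm_mul_le _ _).trans (mul_le_mul_of_nonneg_right (norm_mul_le _ _) (norm_nonneg _))
      _ ≤ C * ‖S t - S s‖ * C := by gcongr <;> exact hT _
      _ = _ := by ring
  have hcau : Cauchy (map T l) := by
    have hc := hS.cauchy_map
    rw [Metric.cauchy_iff] at hc ⊢
    refine ⟨‹l.NeBot›.map _, fun ε hε => ?_⟩
    obtain ⟨u, hu, h⟩ := hc.2 (ε / (C * C + 1)) (by positivity)
    refine ⟨T '' (S ⁻¹' u), image_mem_map hu, ?_⟩
    rintro _ ⟨x, hx, rfl⟩ _ ⟨y, hy, rfl⟩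
    have h1 := h _ hx _ hy
    rw [dist_eq_norm] at h1 ⊢
    rw [lt_div_iff₀ (by positivity)] at h1
    nlinarith [hle x y, norm_nonneg (S x - S y)]
  obtain ⟨T₀, hT₀⟩ := cauchy_map_iff_exists_tendsto.1 hcau
  refine ⟨T₀, hT₀, ?_, ?_⟩
  · exact tendsto_nhds_unique (hS.mul hT₀) (by simp only [hST]; exact tendsto_const_nhds)
  · exact tendsto_nhds_unique (hT₀.mul hS) (by simp only [hTS]; exact tendsto_const_nhds)

end HypSys

/-! ### Multiplication operators on `L²` and the weak equation on the Fourier side. -/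

namespace HypSys

variable {n m : ℕ}

theorem aestronglyMeasurable_apply {X : Type*} [MeasurableSpace X] {μ : Measure X} {σ : X → Op m}
    {f : X → Cm m} (hσ : AEStronglyMeasurable σ μ) (hf : AEStronglyMeasurable f μ) :
    AEStronglyMeasurable (fun x => σ x (f x)) μ :=
  (continuous_fst.clm_apply continuous_snd : Continuous fun p : Op m × Cm m => p.1 p.2)
    |>.comp_aestronglyMeasurable (hσ.prodMk hf)

/-- A measurable bounded operator-valued symbol. -/
structure IsBddSymbol (σ : Rn n → Op m) (C : ℝ) : Prop where
  meas : StronglyMeasurable σ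
  bound : ∀ ξ, ‖σ ξ‖ ≤ C

theorem IsBddSymbol.nonneg {σ : Rn n → Op m} {C : ℝ} (h : IsBddSymbol σ C) : 0 ≤ C :=
  (norm_nonneg _).trans (h.bound 0)

theorem IsBddSymbol.memLp {σ : Rn n → Op m} {C : ℝ} (h : IsBddSymbol σ C) (f : L2 n m) :
    MemLp (fun ξ => σ ξ (f ξ)) 2 volume :=
  (Lp.memLp f).of_le_mul (c := C)
    (aestronglyMeasurable_apply h.meas.aestronglyMeasurable (Lp.aestronglyMeasurable f))
    (ae_of_all _ fun ξ => ((σ ξ).le_opNorm _).trans (by gcongr; exact h.bound ξ))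

open Classical in
/-- Multiplication by a symbol on `L²(ℝⁿ; ℂᵐ)`; zero if it does not preserve square
integrability. -/
noncomputable def mulOp (σ : Rn n → Op m) (f : L2 n m) : L2 n m :=
  if h : MemLp (fun ξ => σ ξ (f ξ)) 2 volume then h.toLp _ else 0

section

variable {σ τ : Rn n → Op m} {C D : ℝ}

theorem coeFn_mulOp (h : IsBddSymbol σ C) (f : L2 n m) :
    mulOp σ f =ᵐ[volume] fun ξ => σ ξ (f ξ) := by
  rw [mulOp, dif_pos (h.memLp f)]
  exact (h.memLp f).coeFn_toLp

theorem norm_mulOp_le (h : IsBddSymbol σ C) (f : L2 n m) : ‖mulOp σ f‖ ≤ C * ‖f‖ := by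
  refine Lp.norm_le_mul_norm_of_ae_le_mul ?_
  filter_upwards [coeFn_mulOp h f] with ξ hξ
  rw [hξ]
  exact ((σ ξ).le_opNorm _).trans (by gcongr; exact h.bound ξ)

theorem mulOp_add (h : IsBddSymbol σ C) (f g : L2 n m) :
    mulOp σ (f + g) = mulOp σ f + mulOp σ g := by
  refine Lp.ext ?_
  filter_upwards [coeFn_mulOp h f, coeFn_mulOp h g, coeFn_mulOp h (f + g), Lp.coeFn_add f g,
    Lp.coeFn_add (mulOp σ f) (mulOp σ g)] with ξ h1 h2 h3 h4 h5
  rw [h3, h5, h4, Pi.add_apply, Pi.add_apply, h1, h2, map_add]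

theorem mulOp_smul (h : IsBddSymbol σ C) (c : ℂ) (f : L2 n m) :
    mulOp σ (c • f) = c • mulOp σ f := by
  refine Lp.ext ?_
  filter_upwards [coeFn_mulOp h f, coeFn_mulOp h (c • f), Lp.coeFn_smul c f,
    Lp.coeFn_smul c (mulOp σ f)] with ξ h1 h2 h3 h4
  rw [h2, h4, h3, Pi.smul_apply, Pi.smul_apply, h1, map_smul]

/-- Multiplication by a bounded symbol as a bounded operator. -/
noncomputable def mulOpL (h : IsBddSymbol σ C) : L2 n m →L[ℂ] L2 n m :=
  LinearMap.mkContinuous ⟨⟨mulOp σ, mulOp_add h⟩, mulOp_smul h⟩ C (norm_mulOp_le h)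

@[simp] theorem mulOpL_apply (h : IsBddSymbol σ C) (f : L2 n m) : mulOpL h f = mulOp σ f := rfl

theorem mulOp_sub (h : IsBddSymbol σ C) (f g : L2 n m) :
    mulOp σ (f - g) = mulOp σ f - mulOp σ g := by
  simp only [← mulOpL_apply h, map_sub]

theorem IsBddSymbol.mul (h : IsBddSymbol σ C) (h' : IsBddSymbol τ D) :
    IsBddSymbol (fun ξ => σ ξ * τ ξ) (C * D) :=
  ⟨h.meas.mul h'.meas, fun ξ => (norm_mul_le _ _).trans
    (mul_le_mul (h.bound ξ) (h'.bound ξ) (norm_nonneg _) h.nonneg)⟩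

theorem mulOp_mulOp (h : IsBddSymbol σ C) (h' : IsBddSymbol τ D) (f : L2 n m) :
    mulOp σ (mulOp τ f) = mulOp (fun ξ => σ ξ * τ ξ) f := by
  refine Lp.ext ?_
  filter_upwards [coeFn_mulOp h (mulOp τ f), coeFn_mulOp h' f, coeFn_mulOp (h.mul h') f]
    with ξ h1 h2 h3
  rw [h1, h2, h3]; rfl

theorem mulOp_mulOp_of_mul_eq_one (h : IsBddSymbol σ C) (h' : IsBddSymbol τ D)
    (h1 : ∀ ξ, σ ξ * τ ξ = 1) (f : L2 n m) : mulOp σ (mulOp τ f) = f := by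
  rw [mulOp_mulOp h h']
  refine Lp.ext ?_
  filter_upwards [coeFn_mulOp (h.mul h') f] with ξ h2
  rw [h2, h1]; rfl

theorem norm_sq_eq_integral (f : L2 n m) : ‖f‖ ^ 2 = ∫ ξ, ‖f ξ‖ ^ 2 := by
  have h := inner_self_eq_norm_sq_to_K (𝕜 := ℂ) f
  rw [L2.inner_def] at h
  simp only [inner_self_eq_norm_sq_to_K] at h
  have h2 : (((∫ ξ, ‖f ξ‖ ^ 2 : ℝ)) : ℂ) = ((‖f‖ ^ 2 : ℝ) : ℂ) := by
    rw [← integral_complex_ofReal]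
    simpa using h
  exact_mod_cast h2.symm

/-- Strong convergence of multiplication operators by dominated convergence. -/
theorem tendsto_mulOp {ι : Type*} {l : Filter ι} [l.IsCountablyGenerated] {σ : ι → Rn n → Op m}
    {σ₀ : Rn n → Op m} (h : ∀ t, IsBddSymbol (σ t) C) (h₀ : IsBddSymbol σ₀ D)
    (hlim : ∀ ξ, Tendsto (fun t => σ t ξ) l (𝓝 (σ₀ ξ))) (f : L2 n m) :
    Tendsto (fun t => mulOp (σ t) f) l (𝓝 (mulOp σ₀ f)) := by
  rw [tendsto_iff_norm_sub_tendsto_zero]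
  have hsq : Tendsto (fun t => ‖mulOp (σ t) f - mulOp σ₀ f‖ ^ 2) l (𝓝 0) := by
    have hint : Integrable (fun ξ => ‖f ξ‖ ^ 2) volume :=
      (memLp_two_iff_integrable_sq_norm (Lp.aestronglyMeasurable f)).1 (Lp.memLp f)
    have hae : ∀ t, ∀ᵐ ξ, (mulOp (σ t) f - mulOp σ₀ f : L2 n m) ξ = (σ t ξ - σ₀ ξ) (f ξ) :=
      fun t => by
        filter_upwards [coeFn_mulOp (h t) f, coeFn_mulOp h₀ f,
          Lp.coeFn_sub (mulOp (σ t) f) (mulOp σ₀ f)] with ξ h1 h2 h3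
        rw [h3, Pi.sub_apply, h1, h2]; rfl
    have heq : ∀ t, ‖mulOp (σ t) f - mulOp σ₀ f‖ ^ 2 = ∫ ξ, ‖(σ t ξ - σ₀ ξ) (f ξ)‖ ^ 2 :=
      fun t => by
        rw [norm_sq_eq_integral]
        refine integral_congr_ae ?_
        filter_upwards [hae t] with ξ hξ
        rw [hξ]
    simp only [heq]
    have h0 : (0 : ℝ) = ∫ _ : Rn n, (0 : ℝ) := by simp
    rw [h0]
    refine tendsto_integral_filter_of_dominated_convergence
      (fun ξ => (C + D) ^ 2 * ‖f ξ‖ ^ 2) (Eventually.of_forall fun t => ?_)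
      (Eventually.of_forall fun t => ae_of_all _ fun ξ => ?_) (hint.const_mul _)
      (ae_of_all _ fun ξ => ?_)
    · exact (aestronglyMeasurable_apply ((h t).meas.sub h₀.meas).aestronglyMeasurable
        (Lp.aestronglyMeasurable f)).norm.pow 2
    · rw [Real.norm_of_nonneg (by positivity), ← mul_pow]
      gcongr
      refine (ContinuousLinearMap.le_opNorm _ _).trans ?_
      gcongr
      exact (norm_sub_le _ _).trans (add_le_add ((h t).bound ξ) (h₀.bound ξ))
    · have h1 : Tendsto (fun t => σ t ξ - σ₀ ξ) l (𝓝 0) := by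
        simpa using (hlim ξ).sub_const (σ₀ ξ)
      have h2 : Tendsto (fun t => (σ t ξ - σ₀ ξ) (f ξ)) l (𝓝 0) := by
        have h3 := ((ContinuousLinearMap.apply ℂ (Cm m) (f ξ)).continuous.tendsto 0).comp h1
        rwa [map_zero] at h3
      simpa using h2.norm.pow 2
  have := hsq.sqrt
  simpa [Real.sqrt_sq] using this

end

/-- The pairing of a Schwartz function with an `L²` function is the `L²` inner product. -/
theorem integral_inner_schwartz (χ : 𝓢(Rn n, Cm m)) (f : L2 n m) :
    ∫ ξ, inner ℂ (χ ξ) (f ξ) = inner ℂ (χ.toLp 2 : L2 n m) f := by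
  rw [L2.inner_def]
  refine integral_congr_ae ?_
  filter_upwards [χ.coeFn_toLp 2 volume] with ξ hξ
  rw [hξ]

/-- Schwartz functions are dense in `L²`. -/
theorem eq_of_forall_inner_schwartz_eq {f g : L2 n m}
    (h : ∀ χ : 𝓢(Rn n, Cm m), ∫ ξ, inner ℂ (χ ξ) (f ξ) = ∫ ξ, inner ℂ (χ ξ) (g ξ)) : f = g := by
  simp only [integral_inner_schwartz] at h
  have hd : DenseRange (SchwartzMap.toLpCLM ℂ (E := Rn n) (Cm m) 2 volume) :=
    SchwartzMap.denseRange_toLpCLM ENNReal.ofNat_ne_top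
  have := hd.equalizer (g := fun v : L2 n m => inner ℂ v f) (h := fun v : L2 n m => inner ℂ v g)
    (by fun_prop) (by fun_prop) (funext fun χ => h χ)
  exact ext_inner_left ℂ fun v => congrFun this v

/-- The weak form of `∂_t u = a u` on the Fourier side. -/
def IsWeakSolution (a : ℝ → Rn n → Op m) (u : ℝ → L2 n m) : Prop :=
  Continuous u ∧ ∀ (χ : 𝓢(Rn n, Cm m)) (t : ℝ),
    HasDerivAt (fun s : ℝ => ∫ ξ, inner ℂ (χ ξ) (u s ξ)) (∫ ξ, inner ℂ (χ ξ) (a t ξ (u t ξ))) t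

/-- `a` is the symbol `i A(t, 2πξ)` away from the origin. -/
def Represents (A : ℝ → Symbol n m) (a : ℝ → Rn n → Op m) : Prop :=
  ∀ t ξ, ξ ≠ 0 → a t ξ = Complex.I • toOp (A t ((2 * Real.pi) • ξ))

/-- Since `n > 0` the origin is a null set, so the value of `a` there is irrelevant. -/
theorem I_mul_multiplierPairing (hn : 0 < n) {A : ℝ → Symbol n m} {a : ℝ → Rn n → Op m}
    (h : Represents A a) (t : ℝ) (u : L2 n m) (χ : 𝓢(Rn n, Cm m)) :
    Complex.I * multiplierPairing (A t) u χ =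
      ∫ ξ, inner ℂ ((𝓕 χ : 𝓢(Rn n, Cm m)) ξ) (a t ξ ((𝓕 u : L2 n m) ξ)) := by
  have : Nonempty (Fin n) := ⟨⟨0, hn⟩⟩
  have : Nontrivial (Rn n) := inferInstance
  rw [multiplierPairing, ← integral_const_mul]
  refine integral_congr_ae ?_
  have h0 : ∀ᵐ ξ : Rn n, ξ ≠ 0 := by
    rw [ae_iff]; simp
  filter_upwards [h0] with ξ hξ
  rw [h t ξ hξ, smul_apply, inner_smul_right]
  rfl

/-- Plancherel's identity carries each pairing over, and the Fourier transform permutes the Schwartz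
test functions. -/
theorem isSolution_iff (hn : 0 < n) {A : ℝ → Symbol n m} {a : ℝ → Rn n → Op m}
    (h : Represents A a) (U : ℝ → L2 n m) :
    IsSolution A U ↔ IsWeakSolution a (fun t => 𝓕 (U t)) := by
  have hpair : ∀ (χ : 𝓢(Rn n, Cm m)) (f : L2 n m), ∫ x, inner ℂ (χ x) (f x) =
      ∫ ξ, inner ℂ ((𝓕 χ : 𝓢(Rn n, Cm m)) ξ) ((𝓕 f : L2 n m) ξ) := fun χ f => by
    rw [integral_inner_schwartz, integral_inner_schwartz, ← SchwartzMap.toLp_fourier_eq,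
      Lp.inner_fourier_eq]
  have hc : Continuous U ↔ Continuous (fun t => (𝓕 (U t) : L2 n m)) :=
    ((Lp.fourierTransformₗᵢ (Rn n) (Cm m)).toHomeomorph.comp_continuous_iff).symm
  rw [IsSolution, IsWeakSolution, hc]
  refine and_congr_right fun _ => ?_
  have key : ∀ (χ : 𝓢(Rn n, Cm m)) (t : ℝ),
      HasDerivAt (fun s : ℝ => ∫ x : Rn n, inner ℂ (χ x) (U s x))
        (Complex.I * multiplierPairing (A t) (U t) χ) t ↔
      HasDerivAt (fun s : ℝ => ∫ ξ, inner ℂ ((𝓕 χ : 𝓢(Rn n, Cm m)) ξ) ((𝓕 (U s) : L2 n m) ξ))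
        (∫ ξ, inner ℂ ((𝓕 χ : 𝓢(Rn n, Cm m)) ξ) (a t ξ ((𝓕 (U t) : L2 n m) ξ))) t := by
    intro χ t
    rw [I_mul_multiplierPairing hn h, funext fun s => hpair χ (U s)]
  refine ⟨fun H χ t => ?_, fun H χ t => (key χ t).2 (H (𝓕 χ) t)⟩
  have := (key (𝓕⁻ χ) t).1 (H (𝓕⁻ χ) t)
  simpa only [FourierTransform.fourier_fourierInv_eq] using this

end HypSys

/-! ### The Cauchy problem in `L²`. -/

namespace HypSys

variable {n m : ℕ}

/-- The fundamental solution at time `t` as a symbol. -/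
noncomputable def evol (a : ℝ → Rn n → Op m) (t : ℝ) (ξ : Rn n) : Op m :=
  dyson (fun s => a s ξ) t

/-- The inverse of the fundamental solution at time `t` as a symbol. -/
noncomputable def evolInv (a : ℝ → Rn n → Op m) (t : ℝ) (ξ : Rn n) : Op m :=
  dysonInv (fun s => a s ξ) t

/-- A first order symbol generating a uniformly bounded evolution. -/
structure IsGenerator (a : ℝ → Rn n → Op m) (K C : ℝ) : Prop where
  nonneg : 0 ≤ K
  meas : ∀ t, StronglyMeasurable (a t)
  cont : ∀ ξ, Continuous fun t => a t ξ
  bound : ∀ t ξ, ‖a t ξ‖ ≤ K * ‖ξ‖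
  norm_evol_le : ∀ t ξ, ‖evol a t ξ‖ ≤ C
  norm_evolInv_le : ∀ t ξ, ‖evolInv a t ξ‖ ≤ C

section

variable {a : ℝ → Rn n → Op m} {K C : ℝ}

theorem IsGenerator.isBddSymbol_evol (h : IsGenerator a K C) (t : ℝ) :
    IsBddSymbol (evol a t) C :=
  ⟨stronglyMeasurable_dyson h.cont h.meas (fun ξ => ⟨_, fun t => h.bound t ξ⟩) t,
    h.norm_evol_le t⟩

theorem IsGenerator.isBddSymbol_evolInv (h : IsGenerator a K C) (t : ℝ) :
    IsBddSymbol (evolInv a t) C :=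
  ⟨stronglyMeasurable_dysonInv h.cont h.meas (fun ξ => ⟨_, fun t => h.bound t ξ⟩) t,
    h.norm_evolInv_le t⟩

theorem IsGenerator.hasDerivAt_evol (h : IsGenerator a K C) (ξ : Rn n) (t : ℝ) :
    HasDerivAt (fun t => evol a t ξ) (a t ξ * evol a t ξ) t :=
  hasDerivAt_dyson (h.cont ξ) (fun t => h.bound t ξ) t

theorem IsGenerator.evolInv_mul_evol (h : IsGenerator a K C) (t : ℝ) (ξ : Rn n) :
    evolInv a t ξ * evol a t ξ = 1 :=
  dysonInv_mul_dyson (h.cont ξ) (fun t => h.bound t ξ) t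

theorem IsGenerator.evol_mul_evolInv (h : IsGenerator a K C) (t : ℝ) (ξ : Rn n) :
    evol a t ξ * evolInv a t ξ = 1 :=
  dyson_mul_dysonInv (h.cont ξ) (fun t => h.bound t ξ) t

theorem evol_zero (a : ℝ → Rn n → Op m) (ξ : Rn n) : evol a 0 ξ = 1 := dyson_zero

theorem mulOp_evol_zero (h : IsGenerator a K C) (f : L2 n m) : mulOp (evol a 0) f = f := by
  refine Lp.ext ?_
  filter_upwards [coeFn_mulOp (h.isBddSymbol_evol 0) f] with ξ hξ
  rw [hξ, evol_zero]; rfl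

/-- Decay of the test function absorbs the linear growth of the generator in `ξ`. -/
theorem memLp_norm_mul_schwartz (χ : 𝓢(Rn n, Cm m)) :
    MemLp (fun ξ => ‖ξ‖ * ‖χ ξ‖) 2 (volume : Measure (Rn n)) := by
  have hc : Continuous (fun ξ => ‖ξ‖ * ‖χ ξ‖) := continuous_norm.mul χ.continuous.norm
  rw [memLp_two_iff_integrable_sq hc.aestronglyMeasurable]
  have h1 := (χ.integrable_pow_mul volume 2).mul_const (SchwartzMap.seminorm ℝ 0 0 χ)
  refine h1.mono' (hc.pow 2).aestronglyMeasurable (ae_of_all _ fun ξ => ?_)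
  rw [Real.norm_of_nonneg (by positivity), mul_pow, pow_two ‖χ ξ‖, ← mul_assoc]
  gcongr
  exact SchwartzMap.norm_le_seminorm ℝ χ ξ

/-- Existence of weak solutions. -/
theorem IsGenerator.isWeakSolution (h : IsGenerator a K C) (f : L2 n m) :
    IsWeakSolution a (fun t => mulOp (evol a t) f) := by
  have hC : 0 ≤ C := (h.isBddSymbol_evol 0).nonneg
  have hK := h.nonneg
  refine ⟨continuous_iff_continuousAt.2 fun t => ?_, fun χ t => ?_⟩
  · exact tendsto_mulOp h.isBddSymbol_evol (h.isBddSymbol_evol t)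
      (fun ξ => (h.hasDerivAt_evol ξ t).continuousAt) f
  have hχm : AEStronglyMeasurable χ (volume : Measure (Rn n)) := χ.continuous.aestronglyMeasurable
  have hfm := Lp.aestronglyMeasurable f
  have hev : ∀ s, (∫ ξ, inner ℂ (χ ξ) (mulOp (evol a s) f ξ)) =
      ∫ ξ, inner ℂ (χ ξ) (evol a s ξ (f ξ)) := fun s => by
    refine integral_congr_ae ?_
    filter_upwards [coeFn_mulOp (h.isBddSymbol_evol s) f] with ξ hξ
    rw [hξ]
  have hder : (∫ ξ, inner ℂ (χ ξ) (a t ξ (mulOp (evol a t) f ξ))) =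
      ∫ ξ, inner ℂ (χ ξ) ((a t ξ * evol a t ξ) (f ξ)) := by
    refine integral_congr_ae ?_
    filter_upwards [coeFn_mulOp (h.isBddSymbol_evol t) f] with ξ hξ
    rw [hξ]; rfl
  simp only [hev, hder]
  have hmeas : ∀ s, AEStronglyMeasurable (fun ξ => inner ℂ (χ ξ) (evol a s ξ (f ξ)))
      (volume : Measure (Rn n)) := fun s =>
    hχm.inner (aestronglyMeasurable_apply (h.isBddSymbol_evol s).meas.aestronglyMeasurable hfm)
  -- Differentiation under the integral sign; the dominating function is a product of the two `L²`
  -- functions `|ξ| |χ|` and `|f|`, up to a constant.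
  refine (hasDerivAt_integral_of_dominated_loc_of_deriv_le (s := univ) univ_mem
    (F := fun s ξ => inner ℂ (χ ξ) (evol a s ξ (f ξ)))
    (F' := fun s ξ => inner ℂ (χ ξ) ((a s ξ * evol a s ξ) (f ξ)))
    (bound := fun ξ => K * C * ((‖ξ‖ * ‖χ ξ‖) * ‖f ξ‖))
    (Eventually.of_forall hmeas) ?_ ?_ ?_ ?_ ?_).2
  · refine ((χ.memLp 2 volume).norm.integrable_mul (Lp.memLp f).norm).const_mul C |>.mono'
      (hmeas t) (ae_of_all _ fun ξ => ?_)
    refine (norm_inner_le_norm _ _).trans ?_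
    calc ‖χ ξ‖ * ‖evol a t ξ (f ξ)‖ ≤ ‖χ ξ‖ * (C * ‖f ξ‖) := by
          gcongr
          exact (ContinuousLinearMap.le_opNorm _ _).trans (by gcongr; exact h.norm_evol_le t ξ)
      _ = _ := by simp only [Pi.mul_apply]; ring
  · exact hχm.inner (aestronglyMeasurable_apply
      ((h.meas t).mul (h.isBddSymbol_evol t).meas).aestronglyMeasurable hfm)
  · refine ae_of_all _ fun ξ s _ => (norm_inner_le_norm _ _).trans ?_
    calc ‖χ ξ‖ * ‖(a s ξ * evol a s ξ) (f ξ)‖ ≤ ‖χ ξ‖ * ((K * ‖ξ‖ * C) * ‖f ξ‖) := by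
          gcongr
          refine (ContinuousLinearMap.le_opNorm _ _).trans ?_
          gcongr
          refine (norm_mul_le _ _).trans ?_
          gcongr
          exacts [h.bound s ξ, h.norm_evol_le s ξ]
      _ = _ := by ring
  · exact ((memLp_norm_mul_schwartz χ).integrable_mul (Lp.memLp f).norm).const_mul _
  · refine ae_of_all _ fun ξ s _ => ?_
    have h1 : HasDerivAt (fun s => evol a s ξ (f ξ)) ((a s ξ * evol a s ξ) (f ξ)) s := by
      have := ((ContinuousLinearMap.apply ℂ (Cm m) (f ξ)).restrictScalars ℝ).hasFDerivAt.comp_hasDerivAt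
        s (h.hasDerivAt_evol ξ s)
      exact this
    have := ((innerSL ℂ (χ ξ)).restrictScalars ℝ).hasFDerivAt.comp_hasDerivAt s h1
    exact this

/-- A smooth cutoff function. -/
noncomputable def cutoff (n N : ℕ) : ContDiffBump (0 : Rn n) :=
  ⟨N + 1, N + 2, by positivity, by linarith⟩

/-- The cutoff function as a scalar symbol. -/
noncomputable def cutoffSymbol (n m N : ℕ) (ξ : Rn n) : Op m := (cutoff n N ξ : ℂ) • 1

theorem isBddSymbol_cutoff (N : ℕ) : IsBddSymbol (cutoffSymbol n m N) 1 := by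
  refine ⟨?_, fun ξ => ?_⟩
  · exact ((Complex.continuous_ofReal.comp (cutoff n N).continuous).smul
      continuous_const).stronglyMeasurable
  · rw [cutoffSymbol, norm_smul, Complex.norm_real, Real.norm_of_nonneg (cutoff n N).nonneg]
    exact mul_le_one₀ (cutoff n N).le_one (norm_nonneg _) op_norm_one_le

theorem cutoff_eq_one {N : ℕ} {ξ : Rn n} (h : ‖ξ‖ ≤ N + 1) : cutoff n N ξ = 1 :=
  (cutoff n N).one_of_mem_closedBall (by simpa [cutoff] using h)

open Classical in
/-- The generator truncated to the support of the cutoff function. -/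
noncomputable def truncSymbol (a : ℝ → Rn n → Op m) (N : ℕ) (t : ℝ) (ξ : Rn n) : Op m :=
  if ‖ξ‖ < N + 2 then a t ξ else 0

theorem IsGenerator.isBddSymbol_trunc (h : IsGenerator a K C) (N : ℕ) (t : ℝ) :
    IsBddSymbol (truncSymbol a N t) (K * (N + 2)) := by
  have hK := h.nonneg
  refine ⟨StronglyMeasurable.ite (measurableSet_lt (by fun_prop) (by fun_prop)) (h.meas t)
    stronglyMeasurable_const, fun ξ => ?_⟩
  rw [truncSymbol]
  split_ifs with hξ
  · exact (h.bound t ξ).trans (by gcongr)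
  · simp only [norm_zero]; positivity

theorem IsGenerator.continuous_trunc (h : IsGenerator a K C) (N : ℕ) (ξ : Rn n) :
    Continuous fun t => truncSymbol a N t ξ := by
  simp only [truncSymbol]
  split_ifs
  exacts [h.cont ξ, continuous_const]

/-- Cut off in frequency, a weak solution solves an ordinary differential equation in `L²`. -/
theorem IsGenerator.hasDerivAt_cutoff (h : IsGenerator a K C) {u : ℝ → L2 n m}
    (hu : IsWeakSolution a u) (N : ℕ) (t : ℝ) :
    HasDerivAt (fun t => mulOp (cutoffSymbol n m N) (u t))
      (mulOp (truncSymbol a N t) (mulOp (cutoffSymbol n m N) (u t))) t := by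
  have hη := isBddSymbol_cutoff (n := n) (m := m) N
  set y : ℝ → L2 n m := fun t => mulOp (cutoffSymbol n m N) (u t) with hy
  set z : ℝ → L2 n m := fun t => mulOp (truncSymbol a N t) (y t) with hz
  have hyc : Continuous y := (mulOpL hη).continuous.comp hu.1
  -- The truncated multipliers are strongly continuous in time and uniformly bounded, so the moving
  -- argument `y t` can be replaced by `y t₀`.
  have hzc : Continuous z := by
    refine continuous_iff_continuousAt.2 fun t₀ => ?_
    have h1 : Tendsto (fun t => mulOp (truncSymbol a N t) (y t - y t₀)) (𝓝 t₀) (𝓝 0) := by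
      refine squeeze_zero_norm (fun t => norm_mulOp_le (h.isBddSymbol_trunc N t) _) ?_
      have := ((hyc.tendsto t₀).sub_const (y t₀)).norm.const_mul (K * (N + 2))
      simpa using this
    have h2 := tendsto_mulOp (h.isBddSymbol_trunc N) (h.isBddSymbol_trunc N t₀)
      (fun ξ => (h.continuous_trunc N ξ).tendsto t₀) (y t₀)
    have h3 := h1.add h2
    rw [zero_add] at h3
    refine h3.congr fun t => ?_
    rw [← mulOp_add (h.isBddSymbol_trunc N t), sub_add_cancel]
  have hweak : ∀ (χ : 𝓢(Rn n, Cm m)) (t : ℝ),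
      HasDerivAt (fun s => inner ℂ (χ.toLp 2 : L2 n m) (y s)) (inner ℂ (χ.toLp 2 : L2 n m) (z t)) t := by
    intro χ t
    have hg : Function.HasTemperateGrowth (cutoff n N : Rn n → ℝ) :=
      ((cutoff n N).hasCompactSupport.toSchwartzMap (cutoff n N).contDiff).hasTemperateGrowth
    -- The cutoff is moved onto the test function, which remains Schwartz.
    have hw := hu.2 (SchwartzMap.smulLeftCLM (Cm m) (cutoff n N : Rn n → ℝ) χ) t
    simp only [SchwartzMap.smulLeftCLM_apply_apply hg] at hw
    have e1 : ∀ s, (∫ ξ, inner ℂ ((cutoff n N ξ) • χ ξ) (u s ξ)) =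
        inner ℂ (χ.toLp 2 : L2 n m) (y s) := fun s => by
      rw [← integral_inner_schwartz]
      refine integral_congr_ae ?_
      filter_upwards [coeFn_mulOp hη (u s)] with ξ hξ
      rw [hξ, cutoffSymbol, smul_apply, one_apply_eq_self, inner_smul_right,
        RCLike.real_smul_eq_coe_smul (K := ℂ), inner_smul_left, RCLike.conj_ofReal]
      rfl
    have e2 : (∫ ξ, inner ℂ ((cutoff n N ξ) • χ ξ) (a t ξ (u t ξ))) =
        inner ℂ (χ.toLp 2 : L2 n m) (z t) := by
      rw [← integral_inner_schwartz]
      refine integral_congr_ae ?_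
      filter_upwards [coeFn_mulOp hη (u t), coeFn_mulOp (h.isBddSymbol_trunc N t) (y t)]
        with ξ hξ1 hξ2
      rw [hξ2, hξ1, truncSymbol]
      split_ifs with hlt
      · rw [cutoffSymbol, smul_apply, one_apply_eq_self, map_smul, inner_smul_right,
          RCLike.real_smul_eq_coe_smul (K := ℂ), inner_smul_left, RCLike.conj_ofReal]
        rfl
      -- The truncation radius `N + 2` is exactly the outer radius of the cutoff, so nothing is
      -- lost.
      · have h0 : cutoff n N ξ = 0 := by
          have : ξ ∉ Function.support (cutoff n N) := by
            rw [(cutoff n N).support_eq]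
            simpa [cutoff] using hlt
          simpa using this
        rw [h0]; simp
    simp only [e1] at hw
    rw [← e2]
    exact hw
  -- The strong primitive of the continuous `z` has the same pairings as `y`, so the weak derivative
  -- of `y` is a strong one.
  set Y : ℝ → L2 n m := fun t => y 0 + ∫ s in (0 : ℝ)..t, z s with hY
  have hYd : ∀ t, HasDerivAt Y (z t) t := fun t =>
    (intervalIntegral.integral_hasDerivAt_right (hzc.intervalIntegrable _ _)
      (hzc.stronglyMeasurableAtFilter _ _) hzc.continuousAt).const_add _
  have hYy : Y = y := by
    ext1 t
    refine eq_of_forall_inner_schwartz_eq fun χ => ?_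
    rw [integral_inner_schwartz, integral_inner_schwartz]
    have hd : ∀ t, HasDerivAt (fun s => inner ℂ (χ.toLp 2 : L2 n m) (Y s) -
        inner ℂ (χ.toLp 2 : L2 n m) (y s)) 0 t := fun t => by
      have := (((innerSL ℂ (χ.toLp 2 : L2 n m)).restrictScalars ℝ).hasFDerivAt.comp_hasDerivAt t
        (hYd t)).sub (hweak χ t)
      refine this.congr_deriv ?_
      exact sub_self _
    have := is_const_of_deriv_eq_zero (fun t => (hd t).differentiableAt)
      (fun t => (hd t).deriv) t 0
    have hY0 : Y 0 = y 0 := by simp [hY]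
    rw [hY0, sub_self] at this
    exact sub_eq_zero.1 this
  rw [← hYy]
  exact hYd t

/-- Uniqueness of weak solutions. -/
theorem IsGenerator.weakSolution_unique (h : IsGenerator a K C) {u v : ℝ → L2 n m}
    (hu : IsWeakSolution a u) (hv : IsWeakSolution a v) (h0 : u 0 = v 0) : u = v := by
  have key : ∀ N : ℕ, (fun t => mulOp (cutoffSymbol n m N) (u t)) =
      fun t => mulOp (cutoffSymbol n m N) (v t) := fun N => by
    have hK := h.nonneg
    -- On bounded frequencies the generator is a bounded operator on `L²`, so the Lipschitz
    -- uniqueness theorem applies.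
    refine ODE_solution_unique_univ (t₀ := 0) (s := fun _ => univ)
      (v := fun t w => mulOp (truncSymbol a N t) w) (K := (K * (N + 2)).toNNReal) (fun t => ?_)
      (fun t => ⟨h.hasDerivAt_cutoff hu N t, mem_univ _⟩)
      (fun t => ⟨h.hasDerivAt_cutoff hv N t, mem_univ _⟩) (by simp only [h0])
    refine LipschitzOnWith.of_dist_le_mul fun x _ w _ => ?_
    rw [dist_eq_norm, dist_eq_norm, ← mulOp_sub (h.isBddSymbol_trunc N t),
      Real.coe_toNNReal _ (by positivity)]
    exact norm_mulOp_le (h.isBddSymbol_trunc N t) _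
  ext1 t
  refine Lp.ext ?_
  have hae : ∀ᵐ ξ, ∀ N : ℕ, cutoffSymbol n m N ξ (u t ξ) = cutoffSymbol n m N ξ (v t ξ) := by
    rw [ae_all_iff]
    intro N
    have hη := isBddSymbol_cutoff (n := n) (m := m) N
    filter_upwards [coeFn_mulOp hη (u t), coeFn_mulOp hη (v t)] with ξ h1 h2
    rw [← h1, ← h2, congrFun (key N) t]
  filter_upwards [hae] with ξ hξ
  -- Every fixed frequency lies where some cutoff equals `1`.
  obtain ⟨N, hN⟩ := exists_nat_ge ‖ξ‖
  have := hξ N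
  rwa [cutoffSymbol, cutoff_eq_one (hN.trans (by linarith)), Complex.ofReal_one, one_smul] at this

theorem IsGenerator.isWeakSolution_iff (h : IsGenerator a K C) {u : ℝ → L2 n m} :
    IsWeakSolution a u ↔ ∀ t, u t = mulOp (evol a t) (u 0) := by
  constructor
  · intro hu t
    exact congrFun (h.weakSolution_unique hu (h.isWeakSolution (u 0))
      (mulOp_evol_zero h _).symm) t
  · intro hu
    have := h.isWeakSolution (u 0)
    rwa [← funext hu] at this

end

end HypSys

/-! ### From convergent comparison symbols to wave and scattering operators. -/

namespace HypSys

variable {n m : ℕ}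

section WaveOperator

variable {A B : ℝ → Symbol n m} {a b : ℝ → Rn n → Op m} {K C K' C' : ℝ}

theorem isSolution_iff_evol (hn : 0 < n) (hA : Represents A a) (ha : IsGenerator a K C)
    {U : ℝ → L2 n m} : IsSolution A U ↔ ∀ t, 𝓕 (U t) = mulOp (evol a t) (𝓕 (U 0)) := by
  rw [isSolution_iff hn hA, ha.isWeakSolution_iff]

/-- Well-posedness of the Cauchy problem. -/
theorem existsUnique_solution (hn : 0 < n) (hA : Represents A a) (ha : IsGenerator a K C)
    (f : L2 n m) : ∃! U : ℝ → L2 n m, IsSolution A U ∧ U 0 = f := by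
  have h0 : (𝓕⁻ (mulOp (evol a 0) (𝓕 f)) : L2 n m) = f := by
    rw [mulOp_evol_zero ha, FourierTransform.fourierInv_fourier_eq]
  refine ⟨fun t => 𝓕⁻ (mulOp (evol a t) (𝓕 f)), ⟨?_, h0⟩, ?_⟩
  · rw [isSolution_iff_evol hn hA ha]
    intro t
    rw [h0, FourierTransform.fourier_fourierInv_eq]
  · rintro U ⟨hU, rfl⟩
    ext1 t
    rw [← (isSolution_iff_evol hn hA ha).1 hU t, FourierTransform.fourierInv_fourier_eq]

/-- By Plancherel `‖U - V‖` is the distance of two multiplier evolutions. Applying the free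
evolution or its inverse, both of norm at most `C'`, makes it comparable to `‖y t - g‖`, where `y t`
is the comparison multiplier applied to the datum of `U` and tends to `mulOp Z` of it. -/
theorem asymptotic_iff (hn : 0 < n) (hA : Represents A a) (ha : IsGenerator a K C)
    (hB : Represents B b) (hb : IsGenerator b K' C') {l : Filter ℝ} [l.NeBot]
    [l.IsCountablyGenerated] {Z : Rn n → Op m} {D : ℝ} (hZ : IsBddSymbol Z D)
    (hlim : ∀ ξ, Tendsto (fun t => evolInv b t ξ * evol a t ξ) l (𝓝 (Z ξ)))
    {U V : ℝ → L2 n m} (hU : IsSolution A U) (hV : IsSolution B V) :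
    Asymptotic l U V ↔ mulOp Z (𝓕 (U 0)) = 𝓕 (V 0) := by
  rw [isSolution_iff_evol hn hA ha] at hU
  rw [isSolution_iff_evol hn hB hb] at hV
  set f : L2 n m := 𝓕 (U 0)
  set g : L2 n m := 𝓕 (V 0)
  have hnorm : ∀ t, ‖U t - V t‖ = ‖mulOp (evol a t) f - mulOp (evol b t) g‖ := fun t => by
    rw [← hU, ← hV]
    exact ((Lp.fourierTransformₗᵢ (Rn n) (Cm m)).norm_map (U t - V t)).symm.trans
      (congrArg norm (map_sub (Lp.fourierTransformₗᵢ (Rn n) (Cm m)) (U t) (V t)))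
  set y : ℝ → L2 n m := fun t => mulOp (fun ξ => evolInv b t ξ * evol a t ξ) f with hy
  have hy' : ∀ t, y t = mulOp (evolInv b t) (mulOp (evol a t) f) := fun t =>
    (mulOp_mulOp (hb.isBddSymbol_evolInv t) (ha.isBddSymbol_evol t) f).symm
  have hylim : Tendsto y l (𝓝 (mulOp Z f)) :=
    tendsto_mulOp (fun t => (hb.isBddSymbol_evolInv t).mul (ha.isBddSymbol_evol t)) hZ hlim f
  have h1 : ∀ t, ‖U t - V t‖ ≤ C' * ‖y t - g‖ := fun t => by
    have e : mulOp (evol a t) f - mulOp (evol b t) g = mulOp (evol b t) (y t - g) := by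
      rw [mulOp_sub (hb.isBddSymbol_evol t), hy', mulOp_mulOp_of_mul_eq_one
        (hb.isBddSymbol_evol t) (hb.isBddSymbol_evolInv t) (hb.evol_mul_evolInv t)]
    rw [hnorm, e]
    exact norm_mulOp_le (hb.isBddSymbol_evol t) _
  have h2 : ∀ t, ‖y t - g‖ ≤ C' * ‖U t - V t‖ := fun t => by
    have e : y t - g = mulOp (evolInv b t) (mulOp (evol a t) f - mulOp (evol b t) g) := by
      rw [mulOp_sub (hb.isBddSymbol_evolInv t), hy', mulOp_mulOp_of_mul_eq_one
        (hb.isBddSymbol_evolInv t) (hb.isBddSymbol_evol t) (hb.evolInv_mul_evol t)]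
    rw [hnorm, e]
    exact norm_mulOp_le (hb.isBddSymbol_evolInv t) _
  constructor
  · intro h
    have : Tendsto y l (𝓝 g) := by
      rw [tendsto_iff_norm_sub_tendsto_zero]
      refine squeeze_zero (fun _ => norm_nonneg _) h2 ?_
      simpa using Tendsto.const_mul C' h
    exact tendsto_nhds_unique hylim this
  · intro h
    rw [h, tendsto_iff_norm_sub_tendsto_zero] at hylim
    refine squeeze_zero (fun _ => norm_nonneg _) h1 ?_
    simpa using hylim.const_mul C'

/-- The wave operators exist as soon as the comparison symbols converge pointwise. -/
theorem exists_waveOperator (hn : 0 < n) {B : Symbol n m} (hA : Represents A a)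
    (ha : IsGenerator a K C) (hB : Represents (fun _ => B) b) (hb : IsGenerator b K' C')
    {l : Filter ℝ} [l.NeBot] [l.IsCountablyGenerated]
    (hlim : ∀ ξ, ∃ Z, Tendsto (fun t => evolInv b t ξ * evol a t ξ) l (𝓝 Z)) :
    ∃ W : L2 n m ≃L[ℂ] L2 n m, IsWaveOperator A B l W ∧ IsInverseWaveOperator A B l W.symm := by
  choose Z hZ using hlim
  -- The inverse comparison symbols are uniformly bounded, so they converge as well and the limit
  -- `Z` is invertible.
  have hinv : ∀ ξ, ∃ T : Op m, Tendsto (fun t => evolInv a t ξ * evol b t ξ) l (𝓝 T) ∧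
      Z ξ * T = 1 ∧ T * Z ξ = 1 := fun ξ => by
    refine exists_tendsto_inverse (hZ ξ) (C := C * C') (fun t =>
      ((ha.isBddSymbol_evolInv t).mul (hb.isBddSymbol_evol t)).bound ξ) (fun t => ?_) (fun t => ?_)
    · rw [mul_assoc, ← mul_assoc (evol a t ξ), ha.evol_mul_evolInv, one_mul, hb.evolInv_mul_evol]
    · rw [mul_assoc, ← mul_assoc (evol b t ξ), hb.evol_mul_evolInv, one_mul, ha.evolInv_mul_evol]
  choose T hT hZT hTZ using hinv
  have hZb : IsBddSymbol Z (C' * C) :=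
    ⟨stronglyMeasurable_of_tendsto l
      (fun t => ((hb.isBddSymbol_evolInv t).mul (ha.isBddSymbol_evol t)).meas)
      (tendsto_pi_nhds.2 hZ), fun ξ => le_of_tendsto (hZ ξ).norm (Eventually.of_forall fun t =>
        ((hb.isBddSymbol_evolInv t).mul (ha.isBddSymbol_evol t)).bound ξ)⟩
  have hTb : IsBddSymbol T (C * C') :=
    ⟨stronglyMeasurable_of_tendsto l
      (fun t => ((ha.isBddSymbol_evolInv t).mul (hb.isBddSymbol_evol t)).meas)
      (tendsto_pi_nhds.2 hT), fun ξ => le_of_tendsto (hT ξ).norm (Eventually.of_forall fun t =>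
        ((ha.isBddSymbol_evolInv t).mul (hb.isBddSymbol_evol t)).bound ξ)⟩
  let F : L2 n m ≃L[ℂ] L2 n m := (Lp.fourierTransformₗᵢ (Rn n) (Cm m)).toContinuousLinearEquiv
  -- `Z` sends the transformed datum of `U` to that of `V`, so the wave operator, going the other
  -- way, is the multiplier `T = Z⁻¹`.
  let E : L2 n m ≃L[ℂ] L2 n m := ContinuousLinearEquiv.equivOfInverse (mulOpL hTb) (mulOpL hZb)
    (mulOp_mulOp_of_mul_eq_one hZb hTb hZT) (mulOp_mulOp_of_mul_eq_one hTb hZb hTZ)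
  let W : L2 n m ≃L[ℂ] L2 n m := F.trans (E.trans F.symm)
  have hW : ∀ U V : ℝ → L2 n m, IsSolution A U → IsFreeSolution B V →
      (Asymptotic l U V ↔ W.symm (U 0) = V 0) := fun U V hU hV => by
    rw [asymptotic_iff hn hA ha hB hb hZb hZ hU hV]
    exact F.symm_apply_eq.symm
  have hexA := existsUnique_solution hn hA ha
  have hexB := existsUnique_solution hn hB hb
  refine ⟨W, ⟨hexB, fun V hV => ?_, fun U V hU hV h => ?_⟩, ⟨hexA, fun U hU => ?_,
    fun U V hU hV h => (hW U V hU hV).1 h⟩⟩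
  · obtain ⟨U, ⟨hU, hU0⟩, huniq⟩ := hexA (W (V 0))
    refine ⟨U, ⟨hU, (hW U V hU hV).2 (by rw [hU0, W.symm_apply_apply])⟩, ?_⟩
    rintro U' ⟨hU', h'⟩
    exact huniq U' ⟨hU', W.symm_apply_eq.1 ((hW U' V hU' hV).1 h')⟩
  · exact (W.symm_apply_eq.1 ((hW U V hU hV).1 h)).symm
  · obtain ⟨V, ⟨hV, hV0⟩, huniq⟩ := hexB (W.symm (U 0))
    refine ⟨V, ⟨hV, (hW U V hU hV).2 hV0.symm⟩, ?_⟩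
    rintro V' ⟨hV', h'⟩
    exact huniq V' ⟨hV', ((hW U V' hU hV').1 h').symm⟩

theorem isScatteringOperator_of_waveOperators {Bm Bp : Symbol n m}
    {Wm Wp : L2 n m ≃L[ℂ] L2 n m} (hm : IsWaveOperator A Bm atBot Wm)
    (hp' : IsInverseWaveOperator A Bp atTop Wp.symm) :
    IsScatteringOperator A Bm Bp (Wm.trans Wp.symm) := by
  intro f g
  constructor
  · rintro rfl
    obtain ⟨Vm, ⟨hVm, rfl⟩, -⟩ := hm.1 f
    obtain ⟨U, ⟨hU, hUm⟩, -⟩ := hm.2.1 Vm hVm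
    obtain ⟨Vp, ⟨hVp, hUp⟩, -⟩ := hp'.2.1 U hU
    refine ⟨Vm, U, Vp, hVm, hU, hVp, hUm, hUp, rfl, ?_⟩
    rw [← hp'.2.2 U Vp hU hVp hUp, ← hm.2.2 U Vm hU hVm hUm]
    rfl
  · rintro ⟨Vm, U, Vp, hVm, hU, hVp, hUm, hUp, rfl, rfl⟩
    rw [← hp'.2.2 U Vp hU hVp hUp, ← hm.2.2 U Vm hU hVm hUm]
    rfl

end WaveOperator

end HypSys

/-! ### Reduction of the given coefficients to paths over the unit sphere. -/

namespace HypSys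

variable {n m : ℕ}

/-- `toOp` as a continuous linear map on arrays of entries. -/
noncomputable def entriesToOp (m : ℕ) : (Fin m → Fin m → ℂ) →L[ℂ] Op m :=
  LinearMap.toContinuousLinearMap
    ((Matrix.toEuclideanCLM (n := Fin m) (𝕜 := ℂ)).toAlgEquiv.toLinearMap.comp
      (Matrix.ofLinearEquiv ℂ : (Fin m → Fin m → ℂ) ≃ₗ[ℂ] Matrix (Fin m) (Fin m) ℂ).toLinearMap)

theorem toOp_smul (c : ℂ) (M : Matrix (Fin m) (Fin m) ℂ) : toOp (c • M) = c • toOp M :=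
  (entriesToOp m).map_smul c fun i j => M i j

theorem norm_entries_le (x : Fin m → Fin m → ℂ) : ‖x‖ ≤ ∑ i, ∑ j, ‖x i j‖ := by
  rw [pi_norm_le_iff_of_nonneg (by positivity)]
  intro i
  rw [pi_norm_le_iff_of_nonneg (by positivity)]
  intro j
  exact (Finset.single_le_sum (f := fun j => ‖x i j‖) (fun _ _ => norm_nonneg _)
    (Finset.mem_univ j)).trans (Finset.single_le_sum (f := fun i => ∑ j, ‖x i j‖)
      (fun _ _ => by positivity) (Finset.mem_univ i))

theorem tendsto_toOp {ι : Type*} {l : Filter ι} {M : ι → Matrix (Fin m) (Fin m) ℂ}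
    {N : Matrix (Fin m) (Fin m) ℂ} (h : ∀ i j, Tendsto (fun t => M t i j) l (𝓝 (N i j))) :
    Tendsto (fun t => toOp (M t)) l (𝓝 (toOp N)) :=
  ((entriesToOp m).continuous.tendsto (fun i j => N i j)).comp
    (tendsto_pi_nhds.2 fun i => tendsto_pi_nhds.2 fun j => h i j)

theorem continuousOn_toOp {X : Type*} [TopologicalSpace X] {s : Set X}
    {M : X → Matrix (Fin m) (Fin m) ℂ} (h : ∀ i j, ContinuousOn (fun x => M x i j) s) :
    ContinuousOn (fun x => toOp (M x)) s := fun x hx => tendsto_toOp fun i j => h i j x hx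

/-- Strongly convergent families of operators on `ℂᵐ` converge in norm. -/
theorem exists_tendsto_op {ι : Type*} {l : Filter ι} {T : ι → Op m}
    (h : ∀ v, ∃ w, Tendsto (fun t => T t v) l (𝓝 w)) : ∃ T₀, Tendsto T l (𝓝 T₀) := by
  choose w hw using h
  let e : Fin m → Cm m := fun j => EuclideanSpace.single j 1
  -- In finite dimension an operator depends linearly and continuously on its values on a basis.
  have key : ∀ S : Op m, S = ∑ j, ContinuousLinearMap.smulRightL ℂ (Cm m) (Cm m)
      (EuclideanSpace.proj j) (S (e j)) := fun S => by
    ext1 v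
    have hv : v = ∑ j, v j • e j := by
      have := (EuclideanSpace.basisFun (Fin m) ℂ).sum_repr v
      simpa [e] using this.symm
    conv_lhs => rw [hv]
    rw [map_sum, sum_apply]
    refine Finset.sum_congr rfl fun j _ => ?_
    rw [map_smul]; rfl
  refine ⟨∑ j, ContinuousLinearMap.smulRightL ℂ (Cm m) (Cm m)
    (EuclideanSpace.proj j) (w (e j)), ?_⟩
  rw [funext fun t => key (T t)]
  exact tendsto_finsetSum _ fun j _ => ((ContinuousLinearMap.smulRightL ℂ (Cm m) (Cm m)
    (EuclideanSpace.proj j)).continuous.tendsto _).comp (hw (e j))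

open Classical in
/-- The Fourier symbol of the generator `i A(t, D_x)`. -/
noncomputable def symbolOf (A : ℝ → Symbol n m) (t : ℝ) (ξ : Rn n) : Op m :=
  if ξ = 0 then 0 else Complex.I • toOp (A t ((2 * Real.pi) • ξ))

theorem represents_symbolOf (A : ℝ → Symbol n m) : Represents A (symbolOf A) :=
  fun _ _ hξ => if_neg hξ

/-- The assumptions say nothing about `A t 0`; with the value zero the evolution at the origin is
the identity. -/
theorem symbolOf_zero (A : ℝ → Symbol n m) (t : ℝ) : symbolOf A t 0 = 0 := if_pos rfl

/-- Positive homogeneity of order one of a symbol. -/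
def IsHomogeneous (A : ℝ → Symbol n m) : Prop :=
  ∀ (t r : ℝ) (ξ : Rn n), 0 < r → ξ ≠ 0 → A t (r • ξ) = (r : ℂ) • A t ξ

/-- Homogeneity moves `|ξ|` into the scalar `r = 2π|ξ|`, leaving a matrix path indexed by the unit
sphere, as in the energy estimate. -/
theorem symbolOf_eq {A : ℝ → Symbol n m} (h : IsHomogeneous A) (t : ℝ) {ξ : Rn n} (hξ : ξ ≠ 0) :
    symbolOf A t ξ =
      (Complex.I * (2 * Real.pi * ‖ξ‖ : ℝ)) • toOp (A t (‖ξ‖⁻¹ • ξ)) := by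
  have hn : 0 < ‖ξ‖ := norm_pos_iff.2 hξ
  have h1 : (2 * Real.pi) • ξ = (2 * Real.pi * ‖ξ‖) • (‖ξ‖⁻¹ • ξ) := by
    rw [smul_smul, mul_assoc, mul_inv_cancel₀ hn.ne', mul_one]
  rw [symbolOf, if_neg hξ, h1, h t _ _ (by positivity) (smul_ne_zero (inv_ne_zero hn.ne') hξ),
    toOp_smul, smul_smul]

theorem evol_of_eq_zero {a : ℝ → Rn n → Op m} {ξ : Rn n} (h : ∀ t, a t ξ = 0) (t : ℝ) :
    evol a t ξ = 1 := by
  have hd : ∀ t, HasDerivAt (fun t => evol a t ξ) 0 t := fun t => by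
    refine (hasDerivAt_dyson (a := fun s => a s ξ) (K := 0) ?_ (fun t => by simp [h]) t).congr_deriv
      (by simp [h])
    simp only [h]; exact continuous_const
  rw [is_const_of_deriv_eq_zero (fun t => (hd t).differentiableAt) (fun t => (hd t).deriv) t 0,
    evol_zero]

theorem evolInv_of_eq_zero {a : ℝ → Rn n → Op m} {ξ : Rn n} (h : ∀ t, a t ξ = 0) (t : ℝ) :
    evolInv a t ξ = 1 := by
  have := dysonInv_mul_dyson (a := fun s => a s ξ) (K := 0)
    (by simp only [h]; exact continuous_const) (fun t => by simp [h]) t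
  have h1 : evolInv a t ξ * evol a t ξ = 1 := this
  rwa [evol_of_eq_zero h, mul_one] at h1

section Generator

variable {A : ℝ → Symbol n m} {φ : Fin m → ℝ → Rn n → ℝ} {α : Rn n → ℝ → ℝ} {R d J : ℝ}

/-- The generator of a homogeneous uniformly hyperbolic system has a bounded evolution. -/
theorem exists_isGenerator (hd : 0 < d) (hA : IsHomogeneous A)
    (hpath : ∀ ω : Rn n, ‖ω‖ = 1 →
      HyperbolicPath (fun t => A t ω) (fun t j => φ j t ω) (α ω) R d J)
    (hmeas : ∀ t, StronglyMeasurable (symbolOf A t)) :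
    ∃ K C, IsGenerator (symbolOf A) K C := by
  obtain ⟨C, hC0, hC⟩ := exists_norm_solution_le m R d J hd
  have hω : ∀ {ξ : Rn n}, ξ ≠ 0 → ‖‖ξ‖⁻¹ • ξ‖ = 1 := fun hξ => norm_smul_inv_norm (𝕜 := ℝ) hξ
  have hcont : ∀ ξ, Continuous fun t => symbolOf A t ξ := fun ξ => by
    by_cases hξ : ξ = 0
    · simp only [hξ, symbolOf_zero]; exact continuous_const
    · simp only [symbolOf_eq hA _ hξ]
      exact Continuous.const_smul (hpath _ (hω hξ)).lip.continuous
        (Complex.I * (2 * Real.pi * ‖ξ‖ : ℝ))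
  have hbound : ∀ t ξ, ‖symbolOf A t ξ‖ ≤ 2 * Real.pi * max R 0 * ‖ξ‖ := fun t ξ => by
    by_cases hξ : ξ = 0
    · simp [hξ, symbolOf_zero]
    · rw [symbolOf_eq hA _ hξ, norm_smul, norm_mul, Complex.norm_I, one_mul, Complex.norm_real,
        Real.norm_of_nonneg (by positivity)]
      calc 2 * Real.pi * ‖ξ‖ * ‖toOp (A t (‖ξ‖⁻¹ • ξ))‖ ≤ 2 * Real.pi * ‖ξ‖ * max R 0 := by
            gcongr
            exact ((hpath _ (hω hξ)).bound t).trans (le_max_left _ _)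
        _ = _ := by ring
  have hsol : ∀ (ξ : Rn n) (v : Cm m), ξ ≠ 0 → ∀ s t,
      ‖evol (symbolOf A) t ξ v‖ ≤ C * ‖evol (symbolOf A) s ξ v‖ := fun ξ v hξ => by
    refine hC _ _ _ (hpath _ (hω hξ)) (2 * Real.pi * ‖ξ‖) (fun t => evol (symbolOf A) t ξ v)
      fun t => ?_
    have h1 := hasDerivAt_dyson (hcont ξ) (fun t => hbound t ξ) t
    have h2 := ((ContinuousLinearMap.apply ℂ (Cm m) v).restrictScalars
      ℝ).hasFDerivAt.comp_hasDerivAt t h1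
    refine h2.congr_deriv ?_
    rw [symbolOf_eq hA _ hξ]; rfl
  -- The `1` in `max C 1` covers the origin, where the evolution is the identity.
  refine ⟨2 * Real.pi * max R 0, max C 1, by positivity, hmeas, hcont, hbound, fun t ξ => ?_,
    fun t ξ => ?_⟩
  · by_cases hξ : ξ = 0
    · rw [hξ, evol_of_eq_zero (symbolOf_zero A)]
      exact op_norm_one_le.trans (le_max_right _ _)
    · refine ContinuousLinearMap.opNorm_le_bound _ (by positivity) fun v => ?_
      have := hsol ξ v hξ 0 t
      rw [evol_zero, one_apply_eq_self] at this
      exact this.trans (by gcongr; exact le_max_left _ _)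
  · by_cases hξ : ξ = 0
    · rw [hξ, evolInv_of_eq_zero (symbolOf_zero A)]
      exact op_norm_one_le.trans (le_max_right _ _)
    · refine ContinuousLinearMap.opNorm_le_bound _ (by positivity) fun v => ?_
      -- The energy estimate from time `t` back to time `0`, for the solution that equals `v` at
      -- time `t`, bounds the inverse.
      have h1 := hsol ξ (evolInv (symbolOf A) t ξ v) hξ t 0
      have h2 : evol (symbolOf A) t ξ (evolInv (symbolOf A) t ξ v) = v := by
        have : evol (symbolOf A) t ξ * evolInv (symbolOf A) t ξ = 1 :=
          dyson_mul_dysonInv (hcont ξ) (fun t => hbound t ξ) t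
        exact congrArg (fun S : Op m => S v) this
      rw [evol_zero, one_apply_eq_self, h2] at h1
      exact h1.trans (by gcongr; exact le_max_left _ _)

/-- Pointwise convergence of the comparison symbols. -/
theorem exists_tendsto_comparison (hA : IsHomogeneous A)
    (hpath : ∀ ω : Rn n, ‖ω‖ = 1 →
      HyperbolicPath (fun t => A t ω) (fun t j => φ j t ω) (α ω) R d J)
    {K C K' C' : ℝ} (ha : IsGenerator (symbolOf A) K C) {l : Filter ℝ}
    (hl : l = atTop ∨ l = atBot) {B : Symbol n m} {φl : Fin m → Rn n → ℝ}
    (hB : IsHomogeneous (fun _ => B)) (hb : IsGenerator (symbolOf fun _ => B) K' C')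
    (hroots : ∀ ω : Rn n, ‖ω‖ = 1 → HasRoots (B ω) (fun j => φl j ω))
    (hinj : ∀ ω : Rn n, ‖ω‖ = 1 → Function.Injective (fun j => φl j ω))
    (hAB : IsLimitSymbol A l B) (hφ : IsLimitRoot φ l φl) (hs : IsStable φ l φl) (ξ : Rn n) :
    ∃ Z, Tendsto (fun t => evolInv (symbolOf fun _ => B) t ξ * evol (symbolOf A) t ξ) l (𝓝 Z) := by
  by_cases hξ : ξ = 0
  · refine ⟨1, ?_⟩
    simp only [hξ, evol_of_eq_zero (symbolOf_zero _), evolInv_of_eq_zero (symbolOf_zero _), mul_one]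
    exact tendsto_const_nhds
  refine exists_tendsto_op fun v => ?_
  have hω : ‖‖ξ‖⁻¹ • ξ‖ = 1 := norm_smul_inv_norm (𝕜 := ℝ) hξ
  set ω := ‖ξ‖⁻¹ • ξ with hωdef
  have hω0 : ω ≠ 0 := fun h => by rw [h, norm_zero] at hω; exact zero_ne_one hω
  refine exists_tendsto_propagator_apply (r := 2 * Real.pi * ‖ξ‖) (hpath ω hω)
    (U := fun t => evol (symbolOf A) t ξ v) (fun t => ?_) hl (hroots ω hω) (hinj ω hω)
    (tendsto_toOp fun i j => hAB ω i j hω0) (fun j => hφ j ω hω0) (fun j => hs j ω hω0)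
    (G := fun t => evolInv (symbolOf fun _ => B) t ξ) dysonInv_zero (fun t => ?_)
  · have h2 := ((ContinuousLinearMap.apply ℂ (Cm m) v).restrictScalars
      ℝ).hasFDerivAt.comp_hasDerivAt t (ha.hasDerivAt_evol ξ t)
    refine h2.congr_deriv ?_
    rw [symbolOf_eq hA _ hξ]; rfl
  · have h1 := hasDerivAt_dysonInv (hb.cont ξ) (fun t => hb.bound t ξ) t
    refine h1.congr_deriv ?_
    rw [symbolOf_eq hB _ hξ, mul_smul_comm]; rfl

end Generator

section Hypotheses

variable {A : ℝ → Symbol n m} {φ : Fin m → ℝ → Rn n → ℝ}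

theorem stronglyMeasurable_symbolOf (hA : IsAdmissible A) (t : ℝ) :
    StronglyMeasurable (symbolOf A t) := by
  have : ProperSpace (Op m) := FiniteDimensional.proper ℂ _
  have : SecondCountableTopology (Op m) := secondCountable_of_proper
  have hc : ContinuousOn (fun ξ : Rn n => Complex.I • toOp (A t ((2 * Real.pi) • ξ))) {0}ᶜ := by
    refine ContinuousOn.const_smul (continuousOn_toOp fun i j => ?_) Complex.I
    refine (hA.continuousOn t i j).comp (continuous_const_smul (2 * Real.pi)).continuousOn ?_
    intro ξ hξ
    exact smul_ne_zero (by positivity) hξ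
  classical
  have h := ContinuousOn.measurable_piecewise (s := ({0} : Set (Rn n)))
    (f := fun _ => (0 : Op m)) continuousOn_const hc (measurableSet_singleton 0)
  have e : symbolOf A t = ({0} : Set (Rn n)).piecewise (fun _ => (0 : Op m))
      (fun ξ : Rn n => Complex.I • toOp (A t ((2 * Real.pi) • ξ))) := by
    ext1 ξ
    by_cases hξ : ξ = 0
    · simp [symbolOf, hξ]
    · simp [symbolOf, hξ, Set.piecewise]
  rw [e]
  exact h.stronglyMeasurable

theorem tendsto_symbolOf {l : Filter ℝ} {B : Symbol n m} (h : IsLimitSymbol A l B) (ξ : Rn n) :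
    Tendsto (fun t => symbolOf A t ξ) l (𝓝 (symbolOf (fun _ => B) 0 ξ)) := by
  by_cases hξ : ξ = 0
  · simp only [hξ, symbolOf_zero]; exact tendsto_const_nhds
  · simp only [symbolOf, if_neg hξ]
    exact (tendsto_toOp fun i j => h _ i j (smul_ne_zero (by positivity) hξ)).const_smul Complex.I

/-- The hypotheses give uniformly hyperbolic paths over the unit sphere. -/
theorem exists_hyperbolicPath (hA : IsAdmissible A) (hφ : IsRegularlyHyperbolic A φ) :
    ∃ (α : Rn n → ℝ → ℝ) (R d J : ℝ), 0 < d ∧ 0 ≤ J ∧ ∀ ω : Rn n, ‖ω‖ = 1 →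
      HyperbolicPath (fun t => A t ω) (fun t j => φ j t ω) (α ω) R d J := by
  obtain ⟨M, hM⟩ := hA.bound_deriv
  obtain ⟨d, hd, hgap⟩ := hφ.gap
  have hne : ∀ {ω : Rn n}, ‖ω‖ = 1 → ω ≠ 0 := fun h h0 => by
    rw [h0, norm_zero] at h; exact zero_ne_one h
  have hcomp : ContinuousOn (fun ω => toOp (A 0 ω)) (Metric.sphere (0 : Rn n) 1) :=
    (continuousOn_toOp fun i j => hA.continuousOn 0 i j).mono fun ω hω =>
      hne (mem_sphere_zero_iff_norm.1 hω)
  -- Compactness of the sphere bounds the matrices at time `0`; at other times they differ by at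
  -- most the integral `J` of the derivative bound, whence the radius `R₀ + J`.
  obtain ⟨R₀, hR₀⟩ := (isCompact_sphere (0 : Rn n) 1).exists_bound_of_continuousOn hcomp
  set Φ := entriesToOp m
  set α : Rn n → ℝ → ℝ := fun ω t => ‖Φ‖ * ∑ i, ∑ j, ‖deriv (fun s => A s ω i j) t‖ with hα
  set J : ℝ := ‖Φ‖ * ∑ _i : Fin m, ∑ _j : Fin m, max M 0 with hJ
  have hJ0 : 0 ≤ J := by positivity
  refine ⟨α, R₀ + J, d, J, hd, hJ0, fun ω hω => ?_⟩
  have hω0 := hne hω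
  have hint : Integrable (α ω) := (integrable_finsetSum _ fun i _ => integrable_finsetSum _
    fun j _ => (hA.integrable_deriv ω i j hω0).norm).const_mul _
  have hile : ∫ t, α ω t ≤ J := by
    rw [hα, hJ]
    simp only
    rw [integral_const_mul, integral_finsetSum _ fun i _ => integrable_finsetSum _
      fun j _ => (hA.integrable_deriv ω i j hω0).norm]
    gcongr with i _
    rw [integral_finsetSum _ fun j _ => (hA.integrable_deriv ω i j hω0).norm]
    gcongr with j _
    exact (hM ω i j hω).trans (le_max_left _ _)
  have hlip : LocallyLipschitz fun t => toOp (A t ω) :=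
    Φ.lipschitz.locallyLipschitz.comp (locallyLipschitz_pi (f := fun t i j => A t ω i j) fun i =>
      locallyLipschitz_pi (f := fun t j => A t ω i j) fun j => hA.locallyLipschitz ω i j hω0)
  have hderiv : ∀ᵐ t, ‖deriv (fun t => toOp (A t ω)) t‖ ≤ α ω t := by
    have hdiff : ∀ᵐ t, ∀ i j, DifferentiableAt ℝ (fun s => A s ω i j) t := by
      rw [ae_all_iff]; intro i
      rw [ae_all_iff]; intro j
      exact ae_differentiableAt_of_locallyLipschitz (hA.locallyLipschitz ω i j hω0)
    filter_upwards [hdiff] with t ht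
    have h1 : HasDerivAt (fun s i j => A s ω i j) (fun i j => deriv (fun s => A s ω i j) t) t :=
      hasDerivAt_pi.2 fun i => hasDerivAt_pi.2 fun j => (ht i j).hasDerivAt
    have h2 : HasDerivAt (fun s => toOp (A s ω)) (Φ fun i j => deriv (fun s => A s ω i j) t) t :=
      (Φ.restrictScalars ℝ).hasFDerivAt.comp_hasDerivAt t h1
    rw [h2.deriv]
    refine (Φ.le_opNorm _).trans ?_
    exact mul_le_mul_of_nonneg_left (norm_entries_le _) (norm_nonneg _)
  refine ⟨hlip, fun t => ?_, hderiv, fun t => by positivity, hint, hile,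
    fun t τ => hφ.det_eq t ω τ hω0, fun j => hφ.continuous_root j ω hω0, hd,
    fun t j k hjk => hgap t ω j k hω hjk⟩
  have h1 := norm_sub_le_integral_univ hlip hint hderiv 0 t
  rw [norm_sub_rev] at h1
  have h2 := hR₀ ω (mem_sphere_zero_iff_norm.2 hω)
  have h3 := norm_le_norm_add_norm_sub (toOp (A 0 ω)) (toOp (A t ω))
  linarith

/-- For fixed `τ` both sides of the root identity are continuous in the matrix and the roots. -/
theorem hasRoots_of_tendsto {ι : Type*} {l : Filter ι} [l.NeBot]
    {M : ι → Matrix (Fin m) (Fin m) ℂ} {N : Matrix (Fin m) (Fin m) ℂ} {ψ : ι → Fin m → ℝ}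
    {χ : Fin m → ℝ} (h : ∀ t, HasRoots (M t) (ψ t))
    (hM : ∀ i j, Tendsto (fun t => M t i j) l (𝓝 (N i j)))
    (hψ : ∀ j, Tendsto (fun t => ψ t j) l (𝓝 (χ j))) : HasRoots N χ := by
  intro τ
  have hM' : Tendsto M l (𝓝 N) := tendsto_pi_nhds.2 fun i => tendsto_pi_nhds.2 fun j => hM i j
  have hc : Continuous fun M : Matrix (Fin m) (Fin m) ℂ =>
      (τ • (1 : Matrix (Fin m) (Fin m) ℂ) - M).det :=
    Continuous.matrix_det (continuous_const.sub continuous_id)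
  refine tendsto_nhds_unique ((hc.tendsto N).comp hM') ?_
  simp only [Function.comp_def, h _ τ]
  exact tendsto_finsetProd _ fun j _ => ((Complex.continuous_ofReal.tendsto _).comp
    (hψ j)).const_sub τ

/-- Wave operators along either end of the time axis. -/
theorem exists_waveOperator_of_admissible (hn : 0 < n) (hA : IsAdmissible A)
    (hφ : IsRegularlyHyperbolic A φ) {l : Filter ℝ} (hl : l = atTop ∨ l = atBot) {B : Symbol n m}
    (hB : IsLimitSymbol A l B) {φl : Fin m → Rn n → ℝ} (hφl : IsLimitRoot φ l φl)
    (hs : IsStable φ l φl) :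
    ∃ W : L2 n m ≃L[ℂ] L2 n m, IsWaveOperator A B l W ∧ IsInverseWaveOperator A B l W.symm := by
  have : l.NeBot := by rcases hl with rfl | rfl <;> infer_instance
  have : l.IsCountablyGenerated := by rcases hl with rfl | rfl <;> infer_instance
  obtain ⟨α, R, d, J, hd, hJ, hpath⟩ := exists_hyperbolicPath hA hφ
  have hne : ∀ {ω : Rn n}, ‖ω‖ = 1 → ω ≠ 0 := fun h h0 => by
    rw [h0, norm_zero] at h; exact zero_ne_one h
  -- Continuity of `B` in `ξ` is not assumed; measurability comes from the pointwise limit.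
  have hmB : ∀ t : ℝ, StronglyMeasurable (symbolOf (fun _ => B) t) := fun t =>
    stronglyMeasurable_of_tendsto l (stronglyMeasurable_symbolOf hA)
      (tendsto_pi_nhds.2 fun ξ => tendsto_symbolOf hB ξ)
  have hBhom : IsHomogeneous (fun _ : ℝ => B) := fun _ r ξ hr hξ => by
    ext i j
    refine tendsto_nhds_unique (hB (r • ξ) i j (smul_ne_zero hr.ne' hξ)) ?_
    have h1 := (hB ξ i j hξ).const_mul (r : ℂ)
    refine h1.congr fun t => ?_
    rw [hA.homogeneous t r ξ hr hξ]; rfl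
  have hroots : ∀ ω : Rn n, ‖ω‖ = 1 → HasRoots (B ω) (fun j => φl j ω) := fun ω hω =>
    hasRoots_of_tendsto (hpath ω hω).roots (fun i j => hB ω i j (hne hω))
      (fun j => hφl j ω (hne hω))
  have hgap : ∀ ω : Rn n, ‖ω‖ = 1 → ∀ j k, j ≠ k → d ≤ |φl j ω - φl k ω| := fun ω hω j k hjk =>
    ge_of_tendsto ((hφl j ω (hne hω)).sub (hφl k ω (hne hω))).abs
      (Eventually.of_forall fun t => (hpath ω hω).gap t j k hjk)
  -- The free system is a constant hyperbolic path with `α = 0`, so the same energy estimate bounds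
  -- its evolution.
  have hpathB : ∀ ω : Rn n, ‖ω‖ = 1 → HyperbolicPath (fun _ => B ω)
      (fun _ j => φl j ω) (fun _ => 0) R d J := fun ω hω =>
    ⟨LocallyLipschitz.const _, fun _ => le_of_tendsto
        (tendsto_toOp fun i j => hB ω i j (hne hω)).norm
        (Eventually.of_forall fun t => (hpath ω hω).bound t),
      ae_of_all _ fun _ => by simp, fun _ => le_rfl, integrable_zero _ _ _, by simpa using hJ,
      fun _ => hroots ω hω, fun _ => continuous_const, hd, fun _ => hgap ω hω⟩
  obtain ⟨K, C, ha⟩ := exists_isGenerator hd hA.homogeneous hpath (stronglyMeasurable_symbolOf hA)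
  obtain ⟨K', C', hb⟩ := exists_isGenerator (A := fun _ => B) (φ := fun j _ ω => φl j ω)
    (α := fun _ _ => 0) hd hBhom hpathB hmB
  exact exists_waveOperator hn (represents_symbolOf A) ha (represents_symbolOf _) hb
    (exists_tendsto_comparison hA.homogeneous hpath ha hl hBhom hb hroots
      (fun ω hω => injective_of_gap hd (hgap ω hω)) hB hφl hs)

end Hypotheses

end HypSys

/-! ### The scattering operator. -/

theorem corollary1p3 {n m : ℕ} (hn : 0 < n)
    (A : ℝ → HypSys.Symbol n m) (φ : Fin m → ℝ → HypSys.Rn n → ℝ)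
    (hA : HypSys.IsAdmissible A) (hφ : HypSys.IsRegularlyHyperbolic A φ)
    (Am Ap : HypSys.Symbol n m)
    (hAm : HypSys.IsLimitSymbol A Filter.atBot Am) (hAp : HypSys.IsLimitSymbol A Filter.atTop Ap)
    (φm φp : Fin m → HypSys.Rn n → ℝ)
    (hφm : HypSys.IsLimitRoot φ Filter.atBot φm) (hφp : HypSys.IsLimitRoot φ Filter.atTop φp)
    (hsm : HypSys.IsStable φ Filter.atBot φm) (hsp : HypSys.IsStable φ Filter.atTop φp)
    (hlim : ∀ (ξ : HypSys.Rn n) (i j : Fin m), ξ ≠ 0 → Ap ξ i j = Am ξ i j) :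
    ∃ Wm Wp S : HypSys.L2 n m ≃L[ℂ] HypSys.L2 n m,
      HypSys.IsWaveOperator A Am Filter.atBot Wm ∧
      HypSys.IsWaveOperator A Ap Filter.atTop Wp ∧
      HypSys.IsInverseWaveOperator A Ap Filter.atTop Wp.symm ∧
      (∀ f : HypSys.L2 n m, S f = Wp.symm (Wm f)) ∧
      HypSys.IsScatteringOperator A Am Ap S := by
  obtain ⟨Wm, hWm, -⟩ :=
    HypSys.exists_waveOperator_of_admissible hn hA hφ (Or.inr rfl) hAm hφm hsm
  obtain ⟨Wp, hWp, hWp'⟩ :=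
    HypSys.exists_waveOperator_of_admissible hn hA hφ (Or.inl rfl) hAp hφp hsp
  exact ⟨Wm, Wp, Wm.trans Wp.symm, hWm, hWp, hWp', fun _ => rfl,
    HypSys.isScatteringOperator_of_waveOperators hWm hWp'⟩
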